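/- **Setting.** Let $X$ be a measurable space with countably generated $\sigma$-algebra and let $\mu$ be a $\sigma$-finite measure on $X$ (for example Lebesgue measure on $\mathbb R^d$). Let $F$ be a non-empty class of probability measures on $X$ that have densities with respect to $\mu$, and let $d_{TV}(P,Q)=\frac12\int_X\left|\frac{dP}{d\mu}-\frac{dQ}{d\mu}\right|d\mu$. *Covers.* For $\gamma\ge\alpha$, the class $F$ admits a $(t,\gamma)$-locally small $\alpha$-cover if there is a set $C\subseteq F$ such that every $P\in F$ has a $Q\in C$ with $d_{TV}(P,Q)\le\alpha$, and $|\{Q\in C: d_{TV}(Q,P)\le\gamma\}|\le t$ for every $P\in F$. *Mixtures.* $k\text{-mix}(F)=\Delta_k\times F^k$, where $\Delta_k$ is the probability simplex in $\mathbb R^k$; the element $(w,f)$ stands for the distribution $\sum_{i=1}^k w_if_i$, and $d_{TV}$ between mixtures is that of these distributions. *Learning and privacy.* An algorithm with $n$ samples is a Markov kernel from $X^n$ to the class. It $(\alpha,\beta)$-PAC-learns the class if for every $f$ in the class, given $n$ i.i.d. samples from $f$, it outputs an $\hat f$ in the class with $d_{TV}(f,\hat f)\le\alpha$ with probability at least $1-\beta$.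 It is $(\varepsilon,\delta)$-DP if for any two datasets $D,D'\in X^n$ that differ in at most one entry, and every measurable set $E$ of outputs, $\Pr[A(D)\in E]\le e^{\varepsilon}\Pr[A(D')\in E]+\delta$. *Notation.* For $C>0$ and $c\in\mathbb N$ write $S_{C,c}(x)=C\,x\,(1+\log(1+x))^c$; this is the form of a soft-$O$ or soft-$\Theta$ bound $\widetilde O(x)$, $\widetilde\Theta(x)$ with hidden constants $C,c$. **Statement.** There are universal constants $C_0,C>0$ and $c_0,c\in\mathbb N$ such that the following holds for all $X,\mu,F$ as above, all $\alpha,\beta,\beta'\in(0,1)$, all integers $k,m\ge1$ and $t\geq 0$, all $\delta\in(0,1]$ and all $0<\varepsilon\le 6k$ (in particular all $0<\varepsilon\le1$). Suppose that $F$ admits a $(t,2\alpha/15)$-locally small $\frac{\alpha}{15}$-cover with respect to $d_{TV}$, and that $F$ is (non-privately) $(\alpha/15,\beta')$-PAC-learnable with $m$ samples, where $$\log(1/\beta')\ \ge\ S_{C_0,c_0}\!\left(\log\!\left(1+\frac{mk\,\log\!\left(1+\frac{t}{\alpha\delta}\right)}{\varepsilon\beta}\right)\right).$$ Then for some $$n\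 \le\ S_{C,c}\!\left(\left(\frac{\log(1/\delta)+k\log t}{\varepsilon}+\frac{mk+k\log(1/\beta)}{\alpha\varepsilon}\right)\cdot\frac{mk+k\log(1/\beta)}{\alpha^3}\right)$$ there is an algorithm with $n$ samples that is $(\varepsilon,\delta)$-DP and $(\alpha,\beta)$-PAC-learns $k\text{-mix}(F)$. -/

import Mathlib

open MeasureTheory ProbabilityTheory

namespace PrivateMixtures

noncomputable section

/-- Total variation distance of two distributions with densities with respect to the reference
measure `μ`: half the `L¹(μ)` distance of the densities. -/
def tvDist {X : Type*} [MeasurableSpace X] (μ P Q : Measure X) : ℝ :=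
  (1 / 2) * ∫ x, |(P.rnDeriv μ x).toReal - (Q.rnDeriv μ x).toReal| ∂μ

/-- `F` is a class of probability distributions that have densities with respect to `μ`. -/
def IsDistributionClass {X : Type*} [MeasurableSpace X] (μ : Measure X)
    (F : Set (Measure X)) : Prop :=
  ∀ P ∈ F, IsProbabilityMeasure P ∧ P ≪ μ

/-- `C` is an `α`-cover of `F` in total variation distance. -/
def IsCover {X : Type*} [MeasurableSpace X] (μ : Measure X) (F C : Set (Measure X))
    (α : ℝ) : Prop :=
  C ⊆ F ∧ ∀ P ∈ F, ∃ Q ∈ C, tvDist μ P Q ≤ α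

/-- `F` admits a `(t, γ)`-locally small `α`-cover in total variation distance: every closed
`γ`-ball centred at a member of `F` contains at most `t` members of the cover. -/
def AdmitsLocallySmallCover {X : Type*} [MeasurableSpace X] (μ : Measure X)
    (F : Set (Measure X)) (t : ℕ) (γ α : ℝ) : Prop :=
  α ≤ γ ∧ ∃ C : Set (Measure X), IsCover μ F C α ∧
    ∀ P ∈ F, {Q ∈ C | tvDist μ Q P ≤ γ}.encard ≤ t

/-- The class `k`-mix(`F`) `= Δ_k × F^k` of `k`-mixtures, each with its weights and its
components. It carries the product σ-algebra, where `F` has the σ-algebra generated by the maps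
`P ↦ P A`, `A` measurable. -/
abbrev KMix {X : Type*} [MeasurableSpace X] (k : ℕ) (F : Set (Measure X)) : Type _ :=
  stdSimplex ℝ (Fin k) × (Fin k → F)

/-- The distribution `∑ i, w i • f i` that underlies a `k`-mixture. -/
def KMix.toMeasure {X : Type*} [MeasurableSpace X] {k : ℕ} {F : Set (Measure X)}
    (g : KMix k F) : Measure X :=
  ∑ i, ENNReal.ofReal (g.1.1 i) • (g.2 i : Measure X)

/-- A randomized algorithm on `n` samples with outputs in `Θ` is a Markov kernel `A` from the
datasets `Fin n → X` to `Θ`; `θ : Θ` is a name of the distribution `P θ`. The algorithm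
`(α, β)`-PAC-learns the class `{P θ}` in total variation distance when for every `θ`, given `n`
i.i.d. samples of `P θ`, with probability at least `1 - β` (over the samples and the algorithm)
its output `θ'` satisfies `tvDist μ (P θ) (P θ') ≤ α`. -/
def IsPACLearner {X Θ : Type*} [MeasurableSpace X] [MeasurableSpace Θ] (μ : Measure X)
    (P : Θ → Measure X) (α β : ℝ) {n : ℕ} (A : Kernel (Fin n → X) Θ) : Prop :=
  ∀ θ : Θ, ENNReal.ofReal (1 - β) ≤
    ((Measure.pi fun _ : Fin n => P θ).bind A) {θ' | tvDist μ (P θ) (P θ') ≤ α}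

/-- Two datasets of the same size are neighbouring if they differ in at most one entry. -/
def Neighbouring {X : Type*} {n : ℕ} (D D' : Fin n → X) : Prop :=
  ∃ i, ∀ j, j ≠ i → D j = D' j

/-- `(ε, δ)`-indistinguishability of two distributions. -/
def Indistinguishable {Y : Type*} [MeasurableSpace Y] (ε δ : ℝ) (P Q : Measure Y) : Prop :=
  ∀ E : Set Y, MeasurableSet E →
    P E ≤ ENNReal.ofReal (Real.exp ε) * Q E + ENNReal.ofReal δ ∧
    Q E ≤ ENNReal.ofReal (Real.exp ε) * P E + ENNReal.ofReal δ

/-- `(ε, δ)`-differential privacy of a randomized algorithm. -/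
def IsDP {X Y : Type*} [MeasurableSpace X] [MeasurableSpace Y] (ε δ : ℝ) {n : ℕ}
    (A : Kernel (Fin n → X) Y) : Prop :=
  ∀ D D' : Fin n → X, Neighbouring D D' → Indistinguishable ε δ (A D) (A D')

/-- The class `{P θ}` is `(α, β)`-PAC-learnable with `n` samples. -/
def PACLearnable {X Θ : Type*} [MeasurableSpace X] [MeasurableSpace Θ] (μ : Measure X)
    (P : Θ → Measure X) (α β : ℝ) (n : ℕ) : Prop :=
  ∃ A : Kernel (Fin n → X) Θ, IsMarkovKernel A ∧ IsPACLearner μ P α β A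

/-- The class `{P θ}` is `(ε, δ)`-DP `(α, β)`-PAC-learnable with `n` samples. -/
def DPPACLearnable {X Θ : Type*} [MeasurableSpace X] [MeasurableSpace Θ] (μ : Measure X)
    (P : Θ → Measure X) (ε δ α β : ℝ) (n : ℕ) : Prop :=
  ∃ A : Kernel (Fin n → X) Θ, IsMarkovKernel A ∧ IsDP ε δ A ∧ IsPACLearner μ P α β A

/-- `C · x · (1 + log (1 + x)) ^ c`: the quantities that are soft-O of `x`, with hidden constants
`C` and `c`, are those that are at most this one. -/
def soft (C : ℝ) (c : ℕ) (x : ℝ) : ℝ :=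
  C * x * (1 + Real.log (1 + x)) ^ c

end

end PrivateMixtures

open PrivateMixtures

/-! The data are cut into `T` independent batches. Each batch votes for finitely many mixtures with
weights on the grid `1 / M` and components in the cover, and a private mechanism releases one of
them. This works if, with high probability, (i) some mixture `h₀`, determined by the unknown `g`
alone, gets a vote from every batch, and (ii) every mixture that gets any vote is close to `g`.

Components: `exists_list_learner` derandomizes the given learner. On input `z` it lists the cover
elements `Q` whose `2a`-ball has posterior mass above `1/2`. Local smallness bounds the list by
`2t`, any two listed elements are `4a`-close because their balls share an output, and an element
covering the true distribution `f` is listed for typical `z`. That element depends only on `f`,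
which yields (i).

Mixtures: a sample of `g` contains an unmarked sample of each component that is not too light, so
the list learner is run on all `m`-tuples of a block (`measure_no_tuple_le`), and on `r` blocks to
amplify the confidence. There are too many lists to trust them all. Each list is therefore replaced
by one representative, the finitely many mixtures of representatives are compared on their Scheffé
sets with fresh samples, as in minimum distance estimation, and only those that fit put their lists
forward. This yields (ii) (`candidateSet_of_typical`).

Privacy: changing one sample changes one batch, hence changes by one the scores of at most `N`
mixtures on each side. A mixture of score `q` is released with weight `e ^ (q ε / 2) - 1`, a default
output with weight of order `N e ^ (ε / 2) / δ`. The weight vanishes at score zero, so the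
infinitely many unvoted mixtures cost nothing (`selectionKernel_le`), and about `log (N / (β δ)) /
ε` batches suffice to beat the default.

`exists_parameters` balances the sizes; the sample size is `T` times the batch size `r * s + s'`. -/

namespace PrivateMixtures

open Set Filter

/-! ### Total variation distance: Scheffé sets, measurability, countability of separated classes. -/

section TotalVariation

variable {X : Type*} [MeasurableSpace X] {μ : Measure X}

theorem tvDist_comm (P Q : Measure X) : tvDist μ P Q = tvDist μ Q P := by
  simp only [tvDist, abs_sub_comm]

theorem tvDist_self (P : Measure X) : tvDist μ P P = 0 := by
  simp [tvDist]

theorem tvDist_nonneg (P Q : Measure X) : 0 ≤ tvDist μ P Q :=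
  mul_nonneg (by norm_num) (integral_nonneg fun _ => abs_nonneg _)

theorem integrable_rnDeriv_sub (P Q : Measure X) [IsFiniteMeasure P] [IsFiniteMeasure Q] :
    Integrable (fun x => (P.rnDeriv μ x).toReal - (Q.rnDeriv μ x).toReal) μ :=
  Measure.integrable_toReal_rnDeriv.sub Measure.integrable_toReal_rnDeriv

theorem tvDist_triangle (P Q R : Measure X) [IsFiniteMeasure P] [IsFiniteMeasure Q]
    [IsFiniteMeasure R] : tvDist μ P R ≤ tvDist μ P Q + tvDist μ Q R := by
  have hPQ := (integrable_rnDeriv_sub (μ := μ) P Q).abs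
  have hQR := (integrable_rnDeriv_sub (μ := μ) Q R).abs
  unfold tvDist
  rw [← mul_add, ← integral_add hPQ hQR]
  refine mul_le_mul_of_nonneg_left (integral_mono (integrable_rnDeriv_sub P R).abs
    (hPQ.add hQR) fun x => ?_) (by norm_num)
  exact abs_sub_le _ _ _

/-- Twice the total variation distance splits over a measurable set and its complement. -/
theorem two_mul_tvDist (P Q : Measure X) [IsFiniteMeasure P] [IsFiniteMeasure Q] {A : Set X}
    (hA : MeasurableSet A) :
    2 * tvDist μ P Q = (∫ x in A, |(P.rnDeriv μ x).toReal - (Q.rnDeriv μ x).toReal| ∂μ)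
      + ∫ x in Aᶜ, |(P.rnDeriv μ x).toReal - (Q.rnDeriv μ x).toReal| ∂μ := by
  rw [integral_add_compl hA (integrable_rnDeriv_sub P Q).abs, tvDist]
  ring

/-- The set on which the density of `P` exceeds that of `Q`. -/
def scheffeSet (μ P Q : Measure X) : Set X :=
  {x | (Q.rnDeriv μ x).toReal < (P.rnDeriv μ x).toReal}

theorem measurableSet_scheffeSet (P Q : Measure X) : MeasurableSet (scheffeSet μ P Q) :=
  measurableSet_lt (Measure.measurable_rnDeriv Q μ).ennreal_toReal
    (Measure.measurable_rnDeriv P μ).ennreal_toReal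

variable [SigmaFinite μ]

theorem real_eq_setIntegral_rnDeriv (P : Measure X) [IsFiniteMeasure P] (hP : P ≪ μ) (A : Set X) :
    P.real A = ∫ x in A, (P.rnDeriv μ x).toReal ∂μ :=
  (Measure.setIntegral_toReal_rnDeriv hP A).symm

theorem setIntegral_rnDeriv_sub (P Q : Measure X) [IsFiniteMeasure P] [IsFiniteMeasure Q]
    (hP : P ≪ μ) (hQ : Q ≪ μ) (A : Set X) :
    ∫ x in A, ((P.rnDeriv μ x).toReal - (Q.rnDeriv μ x).toReal) ∂μ = P.real A - Q.real A := by
  rw [integral_sub Measure.integrable_toReal_rnDeriv.integrableOn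
    Measure.integrable_toReal_rnDeriv.integrableOn, real_eq_setIntegral_rnDeriv P hP A,
    real_eq_setIntegral_rnDeriv Q hQ A]

/-- Both total masses are 1, so the density difference has opposite integrals over `A` and `Aᶜ`, and
each is at most half the L¹ norm. -/
theorem real_sub_real_le_tvDist {P Q : Measure X} [IsProbabilityMeasure P]
    [IsProbabilityMeasure Q] (hP : P ≪ μ) (hQ : Q ≪ μ) {A : Set X} (hA : MeasurableSet A) :
    P.real A - Q.real A ≤ tvDist μ P Q := by
  have h := two_mul_tvDist (μ := μ) P Q hA
  have h1 := setIntegral_rnDeriv_sub P Q hP hQ A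
  have h2 := setIntegral_rnDeriv_sub P Q hP hQ Aᶜ
  have h3 := (abs_le.1 (abs_integral_le_integral_abs (μ := μ.restrict A)
    (f := fun x => (P.rnDeriv μ x).toReal - (Q.rnDeriv μ x).toReal))).2
  have h4 := (abs_le.1 (abs_integral_le_integral_abs (μ := μ.restrict Aᶜ)
    (f := fun x => (P.rnDeriv μ x).toReal - (Q.rnDeriv μ x).toReal))).1
  rw [probReal_compl_eq_one_sub hA, probReal_compl_eq_one_sub hA] at h2
  linarith

theorem abs_real_sub_real_le_tvDist {P Q : Measure X} [IsProbabilityMeasure P]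
    [IsProbabilityMeasure Q] (hP : P ≪ μ) (hQ : Q ≪ μ) {A : Set X} (hA : MeasurableSet A) :
    |P.real A - Q.real A| ≤ tvDist μ P Q :=
  abs_sub_le_iff.2 ⟨real_sub_real_le_tvDist hP hQ hA,
    (real_sub_real_le_tvDist hQ hP hA).trans_eq (tvDist_comm _ _)⟩

/-- The bound by set differences is attained here, because the density difference has constant sign
on the set and on its complement. This gives a description of the distance as a maximum over sets,
free of densities. -/
theorem tvDist_eq_scheffeSet {P Q : Measure X} [IsProbabilityMeasure P]
    [IsProbabilityMeasure Q] (hP : P ≪ μ) (hQ : Q ≪ μ) :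
    tvDist μ P Q = P.real (scheffeSet μ P Q) - Q.real (scheffeSet μ P Q) := by
  have hA := measurableSet_scheffeSet (μ := μ) P Q
  have h := two_mul_tvDist (μ := μ) P Q hA
  have h1 := setIntegral_rnDeriv_sub P Q hP hQ (scheffeSet μ P Q)
  have h2 := setIntegral_rnDeriv_sub P Q hP hQ (scheffeSet μ P Q)ᶜ
  have h3 : ∫ x in scheffeSet μ P Q, |(P.rnDeriv μ x).toReal - (Q.rnDeriv μ x).toReal| ∂μ
      = ∫ x in scheffeSet μ P Q, ((P.rnDeriv μ x).toReal - (Q.rnDeriv μ x).toReal) ∂μ :=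
    setIntegral_congr_fun hA fun x hx => abs_of_pos (sub_pos.2 hx)
  have h4 : ∫ x in (scheffeSet μ P Q)ᶜ, |(P.rnDeriv μ x).toReal - (Q.rnDeriv μ x).toReal| ∂μ
      = ∫ x in (scheffeSet μ P Q)ᶜ, -((P.rnDeriv μ x).toReal - (Q.rnDeriv μ x).toReal) ∂μ :=
    setIntegral_congr_fun hA.compl fun x hx => abs_of_nonpos (sub_nonpos.2 (not_lt.1 hx))
  rw [h3, h4, integral_neg, h1, h2, probReal_compl_eq_one_sub hA,
    probReal_compl_eq_one_sub hA] at h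
  linarith

/-- The total variation distance does not depend on the reference measure. -/
theorem tvDist_eq_of_absolutelyContinuous {ν : Measure X} [SigmaFinite ν] {P Q : Measure X}
    [IsProbabilityMeasure P] [IsProbabilityMeasure Q] (hP : P ≪ μ) (hQ : Q ≪ μ) (hP' : P ≪ ν)
    (hQ' : Q ≪ ν) : tvDist μ P Q = tvDist ν P Q := by
  apply le_antisymm
  · rw [tvDist_eq_scheffeSet hP hQ]
    exact real_sub_real_le_tvDist hP' hQ' (measurableSet_scheffeSet P Q)
  · rw [tvDist_eq_scheffeSet hP' hQ']
    exact real_sub_real_le_tvDist hP hQ (measurableSet_scheffeSet P Q)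

/-- For a fixed `P`, the distance to `P` is a measurable function on a class of distributions. -/
theorem measurable_tvDist [MeasurableSpace.CountablyGenerated X] {F : Set (Measure X)}
    (hF : IsDistributionClass μ F) {P : Measure X} [IsProbabilityMeasure P] (hP : P ≪ μ) :
    Measurable fun Q : F => tvDist μ P Q := by
  let κ : Kernel F X := ⟨fun Q => Q, measurable_subtype_coe⟩
  have : IsMarkovKernel κ := ⟨fun Q => (hF Q Q.2).1⟩
  -- Passing to a finite reference measure leaves the distance unchanged and makes the jointly
  -- measurable kernel Radon–Nikodym derivative available.
  let ν := μ.toFinite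
  have hν : ∀ R : Measure X, R ≪ μ → R ≪ ν := fun R h => h.trans (absolutelyContinuous_toFinite μ)
  let η : Kernel F X := Kernel.const F ν
  have h1 : Measurable fun z : F × X => |(P.rnDeriv ν z.2).toReal - (κ.rnDeriv η z.1 z.2).toReal| :=
    (((Measure.measurable_rnDeriv P ν).comp measurable_snd).ennreal_toReal.sub
      (Kernel.measurable_rnDeriv κ η).ennreal_toReal).abs
  have h2 := (h1.stronglyMeasurable.integral_prod_right' (ν := ν)).measurable.const_mul (1 / 2)
  convert h2 using 2 with Q
  have := (hF Q Q.2).1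
  rw [tvDist_eq_of_absolutelyContinuous hP (hF Q Q.2).2 (hν P hP) (hν Q (hF Q Q.2).2), tvDist]
  congr 1
  refine integral_congr_ae ?_
  filter_upwards [Kernel.rnDeriv_eq_rnDeriv_measure (κ := κ) (η := η) (a := Q)] with x hx
  rw [hx]
  rfl

/-- The total variation distance of two mixtures. -/
theorem tvDist_sum_smul_le {ι : Type*} [Fintype ι] {w v : ι → ℝ} {P Q : ι → Measure X}
    (hw : ∀ i, 0 ≤ w i) (hv : ∀ i, 0 ≤ v i)
    [IsProbabilityMeasure (∑ i, ENNReal.ofReal (w i) • P i)]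
    [IsProbabilityMeasure (∑ i, ENNReal.ofReal (v i) • Q i)]
    (hP : ∀ i, IsProbabilityMeasure (P i) ∧ P i ≪ μ)
    (hQ : ∀ i, IsProbabilityMeasure (Q i) ∧ Q i ≪ μ) {a : ℝ} (ha : ∀ i, w i - v i ≤ a)
    (ha0 : 0 ≤ a) :
    tvDist μ (∑ i, ENNReal.ofReal (w i) • P i) (∑ i, ENNReal.ofReal (v i) • Q i)
      ≤ Fintype.card ι * a + ∑ i, v i * tvDist μ (P i) (Q i) := by
  have hac : ∀ (w : ι → ℝ) (P : ι → Measure X), (∀ i, P i ≪ μ) →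
      (∑ i, ENNReal.ofReal (w i) • P i) ≪ μ := by
    intro w P hP
    refine Finset.sum_induction _ (fun ρ => ρ ≪ μ) (fun a b ha hb => ?_)
      (Measure.AbsolutelyContinuous.zero μ) fun i _ => (hP i).smul_left _
    exact ha.add_left hb
  have happ : ∀ (w : ι → ℝ) (P : ι → Measure X), (∀ i, 0 ≤ w i) →
      (∀ i, IsProbabilityMeasure (P i)) → ∀ A,
      (∑ i, ENNReal.ofReal (w i) • P i).real A = ∑ i, w i * (P i).real A := by
    intro w P hw hP A
    rw [measureReal_def, Measure.finsetSum_apply, ENNReal.toReal_sum]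
    · refine Finset.sum_congr rfl fun i _ => ?_
      simp [measureReal_def, ENNReal.toReal_ofReal (hw i)]
    · intro i _
      have := hP i
      simpa using ENNReal.mul_ne_top ENNReal.ofReal_ne_top (measure_ne_top _ _)
  set R := ∑ i, ENNReal.ofReal (w i) • P i
  set S := ∑ i, ENNReal.ofReal (v i) • Q i
  have hA := measurableSet_scheffeSet (μ := μ) R S
  rw [tvDist_eq_scheffeSet (hac w P fun i => (hP i).2) (hac v Q fun i => (hQ i).2),
    happ w P hw fun i => (hP i).1, happ v Q hv fun i => (hQ i).1]
  set A := scheffeSet μ R S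
  rw [← Finset.sum_sub_distrib, ← nsmul_eq_mul, ← Finset.card_univ, ← Finset.sum_const,
    ← Finset.sum_add_distrib]
  -- Termwise, `w P(A) - v Q(A) = (w - v) P(A) + v (P(A) - Q(A))`. Only this one sign is needed on
  -- the Scheffé set, so an upper bound for `w i - v i` suffices.
  refine Finset.sum_le_sum fun i _ => ?_
  have := (hP i).1
  have := (hQ i).1
  have h1 := real_sub_real_le_tvDist (hP i).2 (hQ i).2 hA
  have h2 : (w i - v i) * (P i).real A ≤ a := by
    refine (mul_le_mul_of_nonneg_right (ha i) measureReal_nonneg).trans ?_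
    exact mul_le_of_le_one_right ha0 measureReal_le_one
  nlinarith [mul_le_mul_of_nonneg_left h1 (hv i)]

/-- A set of distributions each of whose members has only finitely many others nearby is
countable. -/
theorem countable_of_finite_tvDist_le [MeasurableSpace.CountablyGenerated X]
    {C : Set (Measure X)} (hC : ∀ P ∈ C, IsFiniteMeasure P) {r : ℝ} (hr : 0 < r)
    (hfin : ∀ P ∈ C, {Q ∈ C | tvDist μ Q P ≤ r}.Finite) : C.Countable := by
  classical
  have : Fact ((1 : ENNReal) ≠ ⊤) := ⟨ENNReal.one_ne_top⟩
  have hint : ∀ P : C, Integrable (fun x => ((P : Measure X).rnDeriv μ x).toReal) μ := fun P => by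
    have := hC P P.2
    exact Measure.integrable_toReal_rnDeriv
  let φ : C → Lp ℝ 1 μ := fun P => (hint P).toL1 _
  have hdist : ∀ P Q : C, dist (φ P) (φ Q) = 2 * tvDist μ P Q := by
    intro P Q
    rw [dist_eq_norm, ← Integrable.toL1_sub _ _ (hint P) (hint Q), L1.norm_eq_integral_norm,
      tvDist, ← mul_assoc, mul_one_div_cancel two_ne_zero, one_mul]
    refine integral_congr_ae ?_
    filter_upwards [Integrable.coeFn_toL1 ((hint P).sub (hint Q))] with x hx
    rw [hx, Real.norm_eq_abs, Pi.sub_apply]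
  -- L¹(μ) is separable, so countably many balls centred at members of `C` cover `C`, and each ball
  -- holds finitely many members.
  have hsep : TopologicalSpace.IsSeparable (range φ) :=
    TopologicalSpace.IsSeparable.of_separableSpace _
  obtain ⟨D, hD, hDc, hdense⟩ := hsep.exists_countable_dense_subset
  choose g hg using fun y : D => hD y.2
  have hcov : C ⊆ ⋃ y : D, {Q ∈ C | tvDist μ Q (g y) ≤ r} := by
    intro Q hQ
    obtain ⟨y, hy, hlt⟩ := Metric.mem_closure_iff.1 (hdense ⟨⟨Q, hQ⟩, rfl⟩) r hr
    refine mem_iUnion.2 ⟨⟨y, hy⟩, hQ, ?_⟩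
    have h := hdist ⟨Q, hQ⟩ (g ⟨y, hy⟩)
    rw [hg ⟨y, hy⟩] at h
    have h0 := tvDist_nonneg (μ := μ) Q (g ⟨y, hy⟩)
    simp only at h
    linarith
  have := hDc.to_subtype
  exact (countable_iUnion fun y => (hfin _ (g y).2).countable).mono hcov

end TotalVariation

end PrivateMixtures

/-! ### Samples: tuples drawn from one component, independent blocks, empirical frequencies. -/

namespace PrivateMixtures

open Set Filter

section Sampling

variable {X : Type*}

/-- The fraction of the entries of `z` that lie in `A`. -/
noncomputable def empirical {s : ℕ} (z : Fin s → X) (A : Set X) : ℝ :=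
  (∑ l, A.indicator (fun _ => (1 : ℝ)) (z l)) / s

theorem empirical_compl {s : ℕ} (hs : 0 < s) (z : Fin s → X) (A : Set X) :
    empirical z Aᶜ = 1 - empirical z A := by
  have hs' : (s : ℝ) ≠ 0 := by positivity
  rw [empirical, empirical, eq_sub_iff_add_eq, ← add_div, ← Finset.sum_add_distrib]
  simp [indicator_compl_add_self_apply, div_self hs']

variable [MeasurableSpace X]

theorem measurable_empirical {s : ℕ} {A : Set X} (hA : MeasurableSet A) :
    Measurable fun z : Fin s → X => empirical z A := by
  refine Measurable.div_const (Finset.measurable_sum _ fun l _ => ?_) _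
  exact (measurable_const.indicator hA).comp (measurable_pi_apply l)

theorem measurableSet_no_tuple {s m : ℕ} {G : Set (Fin m → X)} (hG : MeasurableSet G) :
    MeasurableSet {y : Fin s → X | ∀ j : Fin m → Fin s, y ∘ j ∉ G} := by
  rw [ofPred_forall]
  refine MeasurableSet.iInter fun j => ?_
  have : Measurable fun y : Fin s → X => y ∘ j :=
    measurable_pi_lambda _ fun i => measurable_pi_apply _
  exact (this hG).compl

theorem pi_fin_succ_apply (P : Measure X) [SigmaFinite P] {s : ℕ} {A : Set (Fin (s + 1) → X)}
    (hA : MeasurableSet A) :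
    (Measure.pi fun _ : Fin (s + 1) => P) A
      = ∫⁻ u, (Measure.pi fun _ : Fin s => P) {y | Fin.cons u y ∈ A} ∂P := by
  have h := (measurePreserving_piFinSuccAbove (fun _ : Fin (s + 1) => P) 0).symm
  rw [← h.measure_preimage hA.nullMeasurableSet, Measure.prod_apply (h.measurable hA)]
  simp [MeasurableEquiv.piFinSuccAbove, preimage, Fin.insertNthEquiv]

theorem measurableSet_cons {s : ℕ} {A : Set (Fin (s + 1) → X)} (hA : MeasurableSet A) (u : X) :
    MeasurableSet {y : Fin s → X | Fin.cons u y ∈ A} := by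
  refine (measurable_pi_lambda _ fun i => ?_ : Measurable fun y : Fin s → X =>
    (Fin.cons u y : Fin (s + 1) → X)) hA
  refine Fin.cases ?_ (fun i => ?_) i
  · simp
  · simpa using measurable_pi_apply i

/-- If `P` has `f` as a component of weight `w`, then a sample of size `s` of `P` contains, except
with a small probability, an `m`-tuple in `G`, when a sample of size `m` of `f` is likely to be
in `G`. -/
theorem measure_no_tuple_le {P f ν : Measure X} [IsProbabilityMeasure P] [IsProbabilityMeasure f]
    {w v ρ : ENNReal} (hwv : w + v = 1) (hρ : w + 2 * v = 2 * ρ) (hP : P = w • f + ν)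
    (hν : ν univ = v) (s : ℕ) : ∀ (m : ℕ) (G : Set (Fin m → X)), MeasurableSet G →
    (Measure.pi fun _ : Fin s => P) {y | ∀ j : Fin m → Fin s, y ∘ j ∉ G}
      ≤ (Measure.pi fun _ : Fin m => f) Gᶜ + 2 ^ m * ρ ^ s := by
  induction s with
  | zero =>
    intro m G _
    refine prob_le_one.trans (le_add_left ?_)
    rw [pow_zero, mul_one]
    exact one_le_pow₀ (by norm_num)
  | succ s ih =>
    intro m G hG
    -- Here `ρ = 1 - w / 2`, and `2 ^ m * ρ ^ s` is the Markov bound for seeing fewer than `m` draws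
    -- from `f` among `s`. The induction follows the first sample: if it comes from `f` it becomes
    -- the first entry of the tuple (`h2`), otherwise it is discarded (`h1`). The recursion closes
    -- because `w * 2 ^ m + v * 2 ^ (m + 1) = 2 ^ (m + 1) * ρ`.
    cases m with
    | zero =>
      by_cases h : G = univ
      · simp [h]
      · have : G = ∅ := by
          by_contra hne
          obtain ⟨z, hz⟩ := nonempty_iff_ne_empty.2 hne
          exact h (eq_univ_of_forall fun z' => Subsingleton.elim z z' ▸ hz)
        refine prob_le_one.trans (le_add_right ?_)
        simp [this]
    | succ m =>
      set a := (Measure.pi fun _ : Fin (m + 1) => f) Gᶜ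
      have hcons : ∀ u, MeasurableSet {z : Fin m → X | Fin.cons u z ∈ G} := measurableSet_cons hG
      rw [pi_fin_succ_apply P (measurableSet_no_tuple hG)]
      set φ : X → ENNReal := fun u => (Measure.pi fun _ : Fin s => P)
        {y | Fin.cons u y ∈ {y : Fin (s + 1) → X | ∀ j : Fin (m + 1) → Fin (s + 1), y ∘ j ∉ G}}
      have h1 : ∀ u, φ u ≤ a + 2 ^ (m + 1) * ρ ^ s := by
        intro u
        refine le_trans (measure_mono ?_) (ih (m + 1) G hG)
        intro y hy j hj
        exact hy (fun i => (j i).succ) hj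
      have h2 : ∀ u, φ u ≤ (Measure.pi fun _ : Fin m => f) {z | Fin.cons u z ∈ Gᶜ}
          + 2 ^ m * ρ ^ s := by
        intro u
        refine le_trans (measure_mono ?_) (ih m _ (hcons u))
        intro y hy j hj
        refine hy (Fin.cons 0 fun i => (j i).succ) ?_
        convert! show (Fin.cons u (y ∘ j) : Fin (m + 1) → X) ∈ G from hj using 1
        funext i
        refine Fin.cases ?_ (fun i => ?_) i <;> simp
      have hmeas : Measurable fun u => (Measure.pi fun _ : Fin m => f) {z | Fin.cons u z ∈ Gᶜ} := by
        have h := (measurePreserving_piFinSuccAbove (fun _ : Fin (m + 1) => f) 0).symm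
        have h' := measurable_measure_prodMk_left (ν := Measure.pi fun _ : Fin m => f)
          (h.measurable hG.compl)
        simpa [MeasurableEquiv.piFinSuccAbove, preimage, Fin.insertNthEquiv] using h'
      calc ∫⁻ u, φ u ∂P = w * ∫⁻ u, φ u ∂f + ∫⁻ u, φ u ∂ν := by
            rw [hP, lintegral_add_measure, lintegral_smul_measure, smul_eq_mul]
        _ ≤ w * (∫⁻ u, ((Measure.pi fun _ : Fin m => f) {z | Fin.cons u z ∈ Gᶜ}
              + 2 ^ m * ρ ^ s) ∂f) + ∫⁻ _, (a + 2 ^ (m + 1) * ρ ^ s) ∂ν :=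
            add_le_add (mul_le_mul_right (lintegral_mono h2) w) (lintegral_mono h1)
        _ = w * (a + 2 ^ m * ρ ^ s) + v * (a + 2 ^ (m + 1) * ρ ^ s) := by
            rw [lintegral_add_left hmeas, ← pi_fin_succ_apply f hG.compl, lintegral_const,
              lintegral_const, hν, measure_univ, mul_one, mul_comm _ v]
        _ = (w + v) * a + 2 ^ m * ρ ^ s * (w + 2 * v) := by ring
        _ = a + 2 ^ (m + 1) * ρ ^ (s + 1) := by rw [hwv, hρ]; ring

theorem measurePreserving_comp_injective {ι κ : Type*} [Fintype ι] [Fintype κ] (P : Measure X)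
    [IsProbabilityMeasure P] {e : ι → κ} (he : Function.Injective e) :
    MeasurePreserving (fun x : κ → X => fun i => x (e i)) (Measure.pi fun _ => P)
      (Measure.pi fun _ => P) := by
  refine ⟨by fun_prop, ?_⟩
  have h := iIndepFun_pi (μ := fun _ : κ => P) (X := fun _ => id) fun _ => aemeasurable_id
  have h' := (iIndepFun_iff_map_fun_eq_pi_map (fun i => (measurable_pi_apply (e i)).aemeasurable)).1
    (h.precomp he)
  refine h'.trans ?_
  congr 1
  funext i
  exact (measurePreserving_eval (fun _ : κ => P) (e i)).map_eq

/-- Restriction of a sample to disjoint sets of indices: `r` blocks and a remainder. -/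
theorem measurePreserving_blocks {κ : Type*} [Fintype κ] (P : Measure X) [IsProbabilityMeasure P]
    {r s s' : ℕ} {e : (Fin r × Fin s) ⊕ Fin s' → κ} (he : Function.Injective e) :
    MeasurePreserving (fun x : κ → X =>
        ((fun i l => x (e (.inl (i, l))), fun l => x (e (.inr l))) :
          (Fin r → Fin s → X) × (Fin s' → X)))
      (Measure.pi fun _ => P)
      ((Measure.pi fun _ => Measure.pi fun _ => P).prod (Measure.pi fun _ => P)) := by
  have h1 := measurePreserving_comp_injective P he
  have h2 := measurePreserving_sumPiEquivProdPi (fun _ : (Fin r × Fin s) ⊕ Fin s' => P)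
  have h3 : MeasurePreserving (MeasurableEquiv.curry (Fin r) (Fin s) X)
      (Measure.pi fun _ => P) (Measure.pi fun _ => Measure.pi fun _ => P) := by
    refine ⟨by fun_prop, ?_⟩
    have h := Measure.infinitePi_map_curry (ι := Fin r) (κ := Fin s) (X := X) fun _ _ => P
    simpa only [Measure.infinitePi_eq_pi] using h
  exact ((h3.prod (MeasurePreserving.id _)).comp h2).comp h1

/-- The inequality needs no measurability of `A`, so the set of typical batches never has to be
shown measurable. -/
theorem measure_preimage_le_of_measurePreserving {α β : Type*} [MeasurableSpace α]
    [MeasurableSpace β] {μ : Measure α} {ν : Measure β} {φ : α → β}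
    (h : MeasurePreserving φ μ ν) (A : Set β) : μ (φ ⁻¹' A) ≤ ν A :=
  (measure_mono (preimage_mono (subset_toMeasurable ν A))).trans_eq <| by
    rw [h.measure_preimage (measurableSet_toMeasurable ν A).nullMeasurableSet,
      measure_toMeasurable]

/-- Hoeffding's inequality: centred indicators are independent and sub-Gaussian with parameter
`1/4`. -/
theorem measureReal_empirical_ge_le (P : Measure X) [IsProbabilityMeasure P] {s : ℕ} (hs : 0 < s)
    {A : Set X} (hA : MeasurableSet A) {e : ℝ} (he : 0 ≤ e) :
    (Measure.pi fun _ : Fin s => P).real {z | P.real A + e ≤ empirical z A}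
      ≤ Real.exp (-(2 * s * e ^ 2)) := by
  have hs' : (0 : ℝ) < s := by positivity
  let Y : Fin s → (Fin s → X) → ℝ := fun l z => A.indicator (fun _ => (1 : ℝ)) (z l)
  have hY : ∀ l, Measurable (Y l) := fun l =>
    (measurable_const.indicator hA).comp (measurable_pi_apply l)
  have hint : ∀ l, ∫ z, Y l z ∂(Measure.pi fun _ : Fin s => P) = P.real A := fun l => by
    have h := integral_comp_eval (μ := fun _ : Fin s => P) (i := l)
      (f := A.indicator fun _ => (1 : ℝ)) (measurable_const.indicator hA).aestronglyMeasurable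
    rw [integral_indicator_const _ hA] at h
    simpa using h
  have hsub : ∀ l ∈ Finset.univ, HasSubgaussianMGF
      (fun z => Y l z - P.real A) ((‖(1 : ℝ) - 0‖₊ / 2) ^ 2) (Measure.pi fun _ : Fin s => P) := by
    intro l _
    rw [← hint l]
    refine hasSubgaussianMGF_of_mem_Icc (hY l).aemeasurable (ae_of_all _ fun z => ?_)
    simp only [Y, indicator]
    split_ifs <;> simp
  have hind : iIndepFun (fun l (z : Fin s → X) => Y l z - P.real A)
      (Measure.pi fun _ : Fin s => P) :=
    iIndepFun_pi (μ := fun _ : Fin s => P)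
      (X := fun _ x => A.indicator (fun _ => (1 : ℝ)) x - P.real A)
      fun _ => ((measurable_const.indicator hA).sub_const _).aemeasurable
  have h := HasSubgaussianMGF.measure_sum_ge_le_of_iIndepFun hind hsub (ε := s * e) (by positivity)
  convert h using 3
  · ext z
    simp only [empirical, Finset.sum_sub_distrib, Y, le_div_iff₀ hs']
    simp only [Finset.sum_const, Finset.card_univ, Fintype.card_fin, nsmul_eq_mul]
    constructor <;> intro h <;> linarith
  · simp
    field_simp

/-- The one-sided bound applied to each set and to its complement, and a union bound. -/
theorem measure_empirical_far_le (P : Measure X) [IsProbabilityMeasure P] {s : ℕ} (hs : 0 < s)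
    {ι : Type*} [Fintype ι] {A : ι → Set X} (hA : ∀ i, MeasurableSet (A i)) {e : ℝ} (he : 0 ≤ e) :
    (Measure.pi fun _ : Fin s => P) {z | ∃ i, e ≤ |P.real (A i) - empirical z (A i)|}
      ≤ ENNReal.ofReal (2 * Fintype.card ι * Real.exp (-(2 * s * e ^ 2))) := by
  have hle : ∀ B : Set X, MeasurableSet B → (Measure.pi fun _ : Fin s => P)
      {z | P.real B + e ≤ empirical z B} ≤ ENNReal.ofReal (Real.exp (-(2 * s * e ^ 2))) :=
    fun B hB => by
      rw [← ofReal_measureReal]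
      exact ENNReal.ofReal_le_ofReal (measureReal_empirical_ge_le P hs hB he)
  calc (Measure.pi fun _ : Fin s => P) {z | ∃ i, e ≤ |P.real (A i) - empirical z (A i)|}
      ≤ (Measure.pi fun _ : Fin s => P) (⋃ i, ({z | P.real (A i) + e ≤ empirical z (A i)} ∪
          {z | P.real (A i)ᶜ + e ≤ empirical z (A i)ᶜ})) := by
        refine measure_mono fun z ⟨i, hi⟩ => mem_iUnion.2 ⟨i, ?_⟩
        rcases le_abs.1 hi with h | h
        · right
          rw [mem_ofPred_eq, empirical_compl hs, probReal_compl_eq_one_sub (hA i)]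
          linarith
        · left
          rw [mem_ofPred_eq]
          linarith
    _ ≤ ∑ i : ι, (ENNReal.ofReal (Real.exp (-(2 * s * e ^ 2)))
          + ENNReal.ofReal (Real.exp (-(2 * s * e ^ 2)))) :=
        (measure_iUnion_fintype_le _ _).trans (Finset.sum_le_sum fun i _ =>
          (measure_union_le _ _).trans (add_le_add (hle _ (hA i)) (hle _ (hA i).compl)))
    _ = ENNReal.ofReal (2 * Fintype.card ι * Real.exp (-(2 * s * e ^ 2))) := by
        rw [← ENNReal.ofReal_add (by positivity) (by positivity), Finset.sum_const,
          Finset.card_univ, nsmul_eq_mul, ← ENNReal.ofReal_natCast,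
          ← ENNReal.ofReal_mul (by positivity)]
        congr 1
        ring

end Sampling

end PrivateMixtures

/-! ### The selection mechanism: privacy and utility for abstract scores. -/

namespace PrivateMixtures

open Set Filter
open scoped ENNReal

section Selection

/-- The weights `(1 + c) ^ q - 1`, in a form without subtraction. -/
noncomputable def scoreWeight (c : ℝ≥0∞) : ℕ → ℝ≥0∞
  | 0 => 0
  | q + 1 => (1 + c) * scoreWeight c q + c

theorem scoreWeight_add_one (c : ℝ≥0∞) (q : ℕ) : scoreWeight c q + 1 = (1 + c) ^ q := by
  induction q with
  | zero => simp [scoreWeight]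
  | succ q ih => rw [scoreWeight, pow_succ, ← ih]; ring

theorem scoreWeight_mono (c : ℝ≥0∞) : Monotone (scoreWeight c) :=
  monotone_nat_of_le_succ fun _ => le_add_right (le_mul_of_one_le_left' le_self_add)

theorem scoreWeight_ne_top {c : ℝ≥0∞} (hc : c ≠ ∞) (q : ℕ) : scoreWeight c q ≠ ∞ := by
  have h : scoreWeight c q + 1 ≠ ∞ := by
    rw [scoreWeight_add_one]
    exact ENNReal.pow_ne_top (ENNReal.add_ne_top.2 ⟨ENNReal.one_ne_top, hc⟩)
  exact (ENNReal.add_ne_top.1 h).1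

theorem tsum_indicator_const {K : Type*} (S : Set K) (c : ℝ≥0∞) :
    ∑' h, S.indicator (fun _ => c) h = c * S.encard := by
  rw [← tsum_subtype S fun _ => c, ENNReal.tsum_set_const, mul_comm]

variable {Ω K Θ : Type*} [MeasurableSpace Θ] (c W : ℝ≥0∞) (q : K → Ω → ℕ) (out : K → Θ) (θ₀ : Θ)

/-- The unnormalized output distribution of the selection mechanism: `out h` has weight
`(1 + c) ^ q h D - 1`, and the default output `θ₀` has weight `W`. -/
noncomputable def selectionWeight (D : Ω) : Measure Θ :=
  W • Measure.dirac θ₀ + Measure.sum fun h => scoreWeight c (q h D) • Measure.dirac (out h)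

/-- The total weight of the selection mechanism. -/
noncomputable def selectionMass (D : Ω) : ℝ≥0∞ :=
  W + ∑' h, scoreWeight c (q h D)

theorem selectionWeight_apply (D : Ω) {E : Set Θ} (hE : MeasurableSet E) :
    selectionWeight c W q out θ₀ D E
      = W * E.indicator 1 θ₀ + ∑' h, scoreWeight c (q h D) * E.indicator 1 (out h) := by
  simp [selectionWeight, Measure.sum_apply _ hE, Measure.dirac_apply' _ hE]

theorem selectionWeight_univ (D : Ω) :
    selectionWeight c W q out θ₀ D univ = selectionMass c W q D := by
  rw [selectionWeight_apply _ _ _ _ _ _ MeasurableSet.univ]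
  simp [selectionMass]

theorem measurable_selectionWeight [MeasurableSpace Ω] [Countable K]
    (hq : ∀ h, Measurable (q h)) : Measurable (selectionWeight c W q out θ₀) := by
  refine Measure.measurable_of_measurable_coe _ fun E hE => ?_
  simp_rw [selectionWeight_apply c W q out θ₀ _ hE]
  refine measurable_const.add (Measurable.tsum fun h => Measurable.mul_const ?_ _)
  exact (Measurable.of_discrete (f := scoreWeight c)).comp (hq h)

theorem measurable_selectionMass [MeasurableSpace Ω] [Countable K]
    (hq : ∀ h, Measurable (q h)) : Measurable (selectionMass c W q) :=
  measurable_const.add <| Measurable.tsum fun h =>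
    (Measurable.of_discrete (f := scoreWeight c)).comp (hq h)

/-- The selection mechanism. -/
noncomputable def selectionKernel [MeasurableSpace Ω] [Countable K]
    (hq : ∀ h, Measurable (q h)) : Kernel Ω Θ where
  toFun D := (selectionMass c W q D)⁻¹ • selectionWeight c W q out θ₀ D
  measurable' := by
    refine Measure.measurable_of_measurable_coe _ fun E hE => ?_
    simp only [Measure.smul_apply, smul_eq_mul]
    exact (measurable_selectionMass c W q hq).inv.mul
      (Measure.measurable_coe hE |>.comp (measurable_selectionWeight c W q out θ₀ hq))

theorem selectionKernel_apply [MeasurableSpace Ω] [Countable K] (hq : ∀ h, Measurable (q h))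
    (D : Ω) (E : Set Θ) : selectionKernel c W q out θ₀ hq D E
      = (selectionMass c W q D)⁻¹ * selectionWeight c W q out θ₀ D E := rfl

variable {c W q}

theorem selectionMass_ne_top (hc : c ≠ ∞) (hW : W ≠ ∞) {D : Ω} (hfin : {h | q h D ≠ 0}.Finite) :
    selectionMass c W q D ≠ ∞ := by
  refine ENNReal.add_ne_top.2 ⟨hW, ?_⟩
  rw [tsum_eq_sum (s := hfin.toFinset)]
  · exact ENNReal.sum_ne_top.2 fun h _ => scoreWeight_ne_top hc _
  · intro h hh
    have : q h D = 0 := by simpa using hh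
    rw [this, scoreWeight]

theorem isMarkovKernel_selectionKernel [MeasurableSpace Ω] [Countable K]
    (hq : ∀ h, Measurable (q h)) (hc : c ≠ ∞) (hW : W ≠ ∞) (hW0 : W ≠ 0)
    (hfin : ∀ D, {h | q h D ≠ 0}.Finite) :
    IsMarkovKernel (selectionKernel c W q out θ₀ hq) := by
  refine ⟨fun D => ⟨?_⟩⟩
  rw [selectionKernel_apply, selectionWeight_univ]
  refine ENNReal.inv_mul_cancel ?_ (selectionMass_ne_top hc hW (hfin D))
  simp [selectionMass, hW0]

/-- One more vote turns a weight `x` into `(1 + c) x + c`. The additive `c` is paid only on `S`, the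
candidates whose score may rise. -/
theorem scoreWeight_le_of_le {D D' : Ω} {S : Set K} (hS : ∀ h ∈ S, q h D ≤ q h D' + 1)
    (hS' : ∀ h ∉ S, q h D ≤ q h D') (h : K) :
    scoreWeight c (q h D) ≤ (1 + c) * scoreWeight c (q h D') + S.indicator (fun _ => c) h := by
  by_cases hh : h ∈ S
  · rw [indicator_of_mem hh]
    exact scoreWeight_mono c (hS h hh)
  · rw [indicator_of_notMem hh, add_zero]
    exact (scoreWeight_mono c (hS' h hh)).trans (le_mul_of_one_le_left' le_self_add)

/-- The default weight absorbs the additive loss: `c * N ≤ c * W`, so the total mass changes by a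
pure factor. -/
theorem selectionMass_le {D D' : Ω} {S : Set K} {N : ℝ≥0∞} (hS : ∀ h ∈ S, q h D ≤ q h D' + 1)
    (hS' : ∀ h ∉ S, q h D ≤ q h D') (hN : (S.encard : ℝ≥0∞) ≤ N) (hNW : N ≤ W) :
    selectionMass c W q D ≤ (1 + c) * selectionMass c W q D' := by
  calc selectionMass c W q D
      ≤ W + ∑' h, ((1 + c) * scoreWeight c (q h D') + S.indicator (fun _ => c) h) :=
        add_le_add_right (ENNReal.tsum_le_tsum (scoreWeight_le_of_le hS hS')) _
    _ = W + ((1 + c) * ∑' h, scoreWeight c (q h D') + c * S.encard) := by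
        rw [ENNReal.tsum_add, ENNReal.tsum_mul_left, tsum_indicator_const]
    _ ≤ W + ((1 + c) * ∑' h, scoreWeight c (q h D') + c * W) := by
        gcongr
        exact hN.trans hNW
    _ = (1 + c) * selectionMass c W q D' := by rw [selectionMass]; ring

/-- The default output may lie outside `E`, so here the additive loss stays; after normalization it
becomes `δ`. -/
theorem selectionWeight_le {D D' : Ω} {S : Set K} {N : ℝ≥0∞} (hS : ∀ h ∈ S, q h D ≤ q h D' + 1)
    (hS' : ∀ h ∉ S, q h D ≤ q h D') (hN : (S.encard : ℝ≥0∞) ≤ N) {E : Set Θ}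
    (hE : MeasurableSet E) :
    selectionWeight c W q out θ₀ D E ≤ (1 + c) * selectionWeight c W q out θ₀ D' E + c * N := by
  rw [selectionWeight_apply _ _ _ _ _ _ hE, selectionWeight_apply _ _ _ _ _ _ hE]
  have hle : ∀ h, scoreWeight c (q h D) * E.indicator 1 (out h)
      ≤ (1 + c) * (scoreWeight c (q h D') * E.indicator 1 (out h))
        + S.indicator (fun _ => c) h := by
    intro h
    by_cases hh : out h ∈ E
    · simpa [hh] using scoreWeight_le_of_le hS hS' h
    · simp [hh]
  calc W * E.indicator 1 θ₀ + ∑' h, scoreWeight c (q h D) * E.indicator 1 (out h)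
      ≤ (1 + c) * (W * E.indicator 1 θ₀)
        + ∑' h, ((1 + c) * (scoreWeight c (q h D') * E.indicator 1 (out h))
          + S.indicator (fun _ => c) h) :=
        add_le_add (le_mul_of_one_le_left' le_self_add) (ENNReal.tsum_le_tsum hle)
    _ = (1 + c) * (W * E.indicator 1 θ₀ + ∑' h, scoreWeight c (q h D') * E.indicator 1 (out h))
        + c * S.encard := by
        rw [ENNReal.tsum_add, ENNReal.tsum_mul_left, tsum_indicator_const]
        ring
    _ ≤ _ := by gcongr

/-- One factor `1 + c` comes from the weight of `E` and one from the normalization. The additive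
term is at most `c * N / W`, since the mass is at least `W`. -/
theorem selectionKernel_le [MeasurableSpace Ω] [Countable K] (hq : ∀ h, Measurable (q h))
    (hc : c ≠ ∞) (hW : W ≠ ∞) (hW0 : W ≠ 0) (hfin : ∀ D, {h | q h D ≠ 0}.Finite)
    {D D' : Ω} {S S' : Set K} {N δ : ℝ≥0∞}
    (hS : ∀ h ∈ S, q h D ≤ q h D' + 1) (hS' : ∀ h ∉ S, q h D ≤ q h D')
    (hR : ∀ h ∈ S', q h D' ≤ q h D + 1) (hR' : ∀ h ∉ S', q h D' ≤ q h D)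
    (hN : (S.encard : ℝ≥0∞) ≤ N) (hN' : (S'.encard : ℝ≥0∞) ≤ N) (hNW : N ≤ W)
    (hδ : c * N ≤ δ * W) {E : Set Θ} (hE : MeasurableSet E) :
    selectionKernel c W q out θ₀ hq D E
      ≤ (1 + c) ^ 2 * selectionKernel c W q out θ₀ hq D' E + δ := by
  have h1 := selectionWeight_le (c := c) (W := W) out θ₀ hS hS' hN hE
  have h2 := selectionMass_le (c := c) (W := W) hR hR' hN' hNW
  have hpos : ∀ D, selectionMass c W q D ≠ 0 := fun D => by simp [selectionMass, hW0]
  have htop : ∀ D, selectionMass c W q D ≠ ∞ := fun D => selectionMass_ne_top hc hW (hfin D)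
  have hc1 : 1 + c ≠ ∞ := ENNReal.add_ne_top.2 ⟨ENNReal.one_ne_top, hc⟩
  rw [selectionKernel_apply, selectionKernel_apply]
  set Z := selectionMass c W q D
  set Z' := selectionMass c W q D'
  have h3 : Z⁻¹ ≤ (1 + c) * Z'⁻¹ := by
    rw [← div_eq_mul_inv, ENNReal.le_div_iff_mul_le (.inl (hpos D')) (.inl (htop D'))]
    calc Z⁻¹ * Z' ≤ Z⁻¹ * ((1 + c) * Z) := by gcongr
      _ = (1 + c) * (Z⁻¹ * Z) := by ring
      _ = 1 + c := by rw [ENNReal.inv_mul_cancel (hpos D) (htop D), mul_one]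
  have h4 : Z⁻¹ * (c * N) ≤ δ := by
    rw [mul_comm, ← div_eq_mul_inv, ENNReal.div_le_iff (hpos D) (htop D)]
    exact hδ.trans (by gcongr; exact le_self_add)
  calc Z⁻¹ * selectionWeight c W q out θ₀ D E
      ≤ Z⁻¹ * ((1 + c) * selectionWeight c W q out θ₀ D' E + c * N) := by gcongr
    _ = Z⁻¹ * ((1 + c) * selectionWeight c W q out θ₀ D' E) + Z⁻¹ * (c * N) := mul_add _ _ _
    _ ≤ ((1 + c) * Z'⁻¹) * ((1 + c) * selectionWeight c W q out θ₀ D' E) + δ := by gcongr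
    _ = _ := by ring

/-- If every candidate with a positive score is in `E` and some candidate has a large score, then
the output of the selection mechanism is likely to be in `E`. -/
theorem one_le_selectionKernel_add [MeasurableSpace Ω] [Countable K] (hq : ∀ h, Measurable (q h))
    (hc : c ≠ ∞) (hW : W ≠ ∞) (hW1 : 1 ≤ W) {D : Ω} (hfin : {h | q h D ≠ 0}.Finite) {E : Set Θ}
    (hE : ∀ h, q h D ≠ 0 → out h ∈ E) {h₀ : K} {T : ℕ} (hT : q h₀ D = T) {η : ℝ≥0∞}
    (hη : W ≤ η * (1 + c) ^ T) : 1 ≤ selectionKernel c W q out θ₀ hq D E + η := by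
  have hpos : selectionMass c W q D ≠ 0 := by
    simp only [selectionMass, ne_eq, add_eq_zero, not_and]
    intro h
    simp [h] at hW1
  have htop := selectionMass_ne_top hc hW hfin
  have h1 : ∑' h, scoreWeight c (q h D) ≤ selectionWeight c W q out θ₀ D E := by
    refine le_trans ?_ (Measure.le_iff'.1 (Measure.le_add_left le_rfl :
      _ ≤ selectionWeight c W q out θ₀ D) E)
    refine le_trans (ENNReal.tsum_le_tsum fun h => ?_) (Measure.le_sum_apply _ _)
    by_cases hh : q h D = 0
    · simp [hh, scoreWeight]
    · have : 1 ≤ Measure.dirac (out h) E := by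
        simp [hE h hh]
      simpa using le_mul_of_one_le_right' this
  -- The default weight `W ≥ 1` makes up for the `1` subtracted in the score weight. The default is
  -- then chosen with probability at most `W / (1 + c) ^ T`.
  have h2 : (1 + c) ^ T ≤ selectionMass c W q D := by
    rw [← scoreWeight_add_one, ← hT, add_comm]
    exact add_le_add hW1 (ENNReal.le_tsum h₀)
  rw [selectionKernel_apply]
  set Z := selectionMass c W q D with hZ
  calc 1 = Z⁻¹ * Z := (ENNReal.inv_mul_cancel hpos htop).symm
    _ = Z⁻¹ * (∑' h, scoreWeight c (q h D)) + Z⁻¹ * W := by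
        nth_rewrite 2 [hZ]
        rw [selectionMass, add_comm W, mul_add]
    _ ≤ Z⁻¹ * selectionWeight c W q out θ₀ D E + η := by
        gcongr
        rw [mul_comm, ← div_eq_mul_inv, ENNReal.div_le_iff hpos htop]
        exact hη.trans (by gcongr)

end Selection

end PrivateMixtures

/-! ### Private selection from the votes of batches. -/

namespace PrivateMixtures

open Set Filter
open scoped ENNReal

/-- The number of indices `b` with `φ b D ∈ A`. -/
noncomputable def hitCount {Ω Y : Type*} {T : ℕ} (φ : Fin T → Ω → Y) (A : Set Y) (D : Ω) : ℕ :=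
  ∑ b, A.indicator (fun _ => 1) (φ b D)

theorem hitCount_ne_zero {Ω Y : Type*} {T : ℕ} {φ : Fin T → Ω → Y} {A : Set Y} {D : Ω} :
    hitCount φ A D ≠ 0 ↔ ∃ b, φ b D ∈ A := by
  simp [hitCount, Finset.sum_eq_zero_iff]

theorem hitCount_le {Ω Y : Type*} {T : ℕ} {φ : Fin T → Ω → Y} {D D' : Ω} {b₀ : Fin T}
    (h : ∀ b, b ≠ b₀ → φ b D = φ b D') (A : Set Y) :
    hitCount φ A D ≤ hitCount φ A D' + A.indicator (fun _ => 1) (φ b₀ D) := by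
  classical
  rw [hitCount, hitCount, ← Finset.add_sum_erase _ _ (Finset.mem_univ b₀),
    ← Finset.add_sum_erase _ _ (Finset.mem_univ b₀),
    Finset.sum_congr rfl fun b hb => by rw [h b (Finset.ne_of_mem_erase hb)]]
  lia

/-- Private selection: given a family of sets `V h` of batches such that every batch is in few of
them, there is a private algorithm that outputs some `out h` with at least one batch in `V h`,
provided some `V h₀` contains all the batches. -/
theorem exists_isDP_selection {X Y K Θ : Type*} [MeasurableSpace X] [MeasurableSpace Y]
    [MeasurableSpace Θ] [Countable K] {n T N : ℕ} (hN : 1 ≤ N) {V : K → Set Y}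
    (hV : ∀ h, MeasurableSet (V h)) (hcard : ∀ y, {h | y ∈ V h}.encard ≤ N)
    {φ : Fin T → (Fin n → X) → Y} (hφ : ∀ b, Measurable (φ b))
    (hnb : ∀ D D', Neighbouring D D' → ∃ b₀, ∀ b, b ≠ b₀ → φ b D = φ b D')
    (out : K → Θ) (θ₀ : Θ) {ε δ η : ℝ} (hε : 0 < ε) (hδ : 0 < δ) (hδ1 : δ ≤ 1) (hη : 0 < η)
    (hT : N * Real.exp (ε / 2) / δ ≤ η * Real.exp (ε / 2) ^ T) :
    ∃ A : Kernel (Fin n → X) Θ, IsMarkovKernel A ∧ IsDP ε δ A ∧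
      ∀ (D : Fin n → X) (E : Set Θ) (h₀ : K), (∀ b, φ b D ∈ V h₀) →
        (∀ b h, φ b D ∈ V h → out h ∈ E) → 1 ≤ A D E + ENNReal.ofReal η := by
  have hN' : (1 : ℝ) ≤ N := by exact_mod_cast hN
  have he : 1 ≤ Real.exp (ε / 2) := Real.one_le_exp (by positivity)
  have hNW : (N : ℝ) ≤ N * Real.exp (ε / 2) / δ := by
    rw [le_div_iff₀ hδ]
    exact mul_le_mul_of_nonneg_left (hδ1.trans he) (by positivity)
  -- The choice of `c` gives `(1 + c) ^ 2 = e ^ ε`. That of `W` gives both `N ≤ W` and `c * N ≤ δ *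
  -- W`.
  let c : ℝ≥0∞ := ENNReal.ofReal (Real.exp (ε / 2) - 1)
  let W : ℝ≥0∞ := ENNReal.ofReal (N * Real.exp (ε / 2) / δ)
  have hc : c ≠ ∞ := ENNReal.ofReal_ne_top
  have hW : W ≠ ∞ := ENNReal.ofReal_ne_top
  have hc1 : 1 + c = ENNReal.ofReal (Real.exp (ε / 2)) := by
    rw [← ENNReal.ofReal_one, ← ENNReal.ofReal_add zero_le_one (by linarith)]
    congr 1
    ring
  have hNW' : (N : ℝ≥0∞) ≤ W := by
    rw [← ENNReal.ofReal_natCast]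
    exact ENNReal.ofReal_le_ofReal hNW
  have hW1 : 1 ≤ W := le_trans (by exact_mod_cast hN) hNW'
  have hW0 : W ≠ 0 := (zero_lt_one.trans_le hW1).ne'
  have hcN : c * N ≤ ENNReal.ofReal δ * W := by
    rw [← ENNReal.ofReal_natCast, ← ENNReal.ofReal_mul (by linarith),
      ← ENNReal.ofReal_mul hδ.le, mul_div_cancel₀ _ hδ.ne']
    exact ENNReal.ofReal_le_ofReal (by nlinarith)
  have hq : ∀ h, Measurable (hitCount φ (V h)) := fun h =>
    Finset.measurable_sum _ fun b _ => (measurable_const.indicator (hV h)).comp (hφ b)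
  have hfin : ∀ D, {h | hitCount φ (V h) D ≠ 0}.Finite := by
    intro D
    simp_rw [hitCount_ne_zero, ofPred_exists]
    exact finite_iUnion fun b =>
      encard_lt_top_iff.1 ((hcard (φ b D)).trans_lt (ENat.natCast_lt_top N))
  have hcard' : ∀ y, ({h | y ∈ V h}.encard : ℝ≥0∞) ≤ N := fun y => by
    exact_mod_cast ENat.toENNReal_le.2 (hcard y)
  have hS : ∀ {D D' : Fin n → X} {b₀ : Fin T}, (∀ b, b ≠ b₀ → φ b D = φ b D') →
      (∀ h ∈ {h | φ b₀ D ∈ V h}, hitCount φ (V h) D ≤ hitCount φ (V h) D' + 1) ∧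
      ∀ h ∉ {h | φ b₀ D ∈ V h}, hitCount φ (V h) D ≤ hitCount φ (V h) D' := by
    intro D D' b₀ hb
    refine ⟨fun h hh => ?_, fun h hh => ?_⟩
    · have := hitCount_le hb (V h)
      rwa [indicator_of_mem (show φ b₀ D ∈ V h from hh)] at this
    · have := hitCount_le hb (V h)
      rwa [indicator_of_notMem (show φ b₀ D ∉ V h from hh)] at this
  refine ⟨selectionKernel c W (fun h => hitCount φ (V h)) out θ₀ hq,
    isMarkovKernel_selectionKernel out θ₀ hq hc hW hW0 hfin, ?_, ?_⟩
  · intro D D' hD E hE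
    obtain ⟨b₀, hb⟩ := hnb D D' hD
    have hb' : ∀ b, b ≠ b₀ → φ b D' = φ b D := fun b h => (hb b h).symm
    have hexp : ENNReal.ofReal (Real.exp ε) = (1 + c) ^ 2 := by
      rw [hc1, ← ENNReal.ofReal_pow (by positivity), ← Real.exp_nat_mul]
      congr 2
      push_cast
      ring
    rw [hexp]
    exact ⟨selectionKernel_le out θ₀ hq hc hW hW0 hfin (hS hb).1 (hS hb).2 (hS hb').1 (hS hb').2
        (hcard' _) (hcard' _) hNW' hcN hE,
      selectionKernel_le out θ₀ hq hc hW hW0 hfin (hS hb').1 (hS hb').2 (hS hb).1 (hS hb).2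
        (hcard' _) (hcard' _) hNW' hcN hE⟩
  · intro D E h₀ h₀V hE
    refine one_le_selectionKernel_add out θ₀ hq hc hW hW1 (hfin D) (fun h hh => ?_)
      (h₀ := h₀) (T := T) ?_ ?_
    · obtain ⟨b, hb⟩ := hitCount_ne_zero.1 hh
      exact hE b h hb
    · simp [hitCount, h₀V]
    · rw [hc1, ← ENNReal.ofReal_pow (by positivity), ← ENNReal.ofReal_mul hη.le]
      exact ENNReal.ofReal_le_ofReal hT

/-- The ball around a member of `F` contains the element that covers it. This excludes `t = 0`, so
that `log t` is nonnegative. -/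
theorem AdmitsLocallySmallCover.one_le {X : Type*} [MeasurableSpace X] {μ : Measure X}
    {F : Set (Measure X)} {t : ℕ} {γ a : ℝ} (h : AdmitsLocallySmallCover μ F t γ a)
    (hne : F.Nonempty) : 1 ≤ t := by
  obtain ⟨hγ, C, hC, ht⟩ := h
  obtain ⟨P, hP⟩ := hne
  obtain ⟨Q, hQ, hPQ⟩ := hC.2 P hP
  rw [tvDist_comm] at hPQ
  have h1 : (1 : ℕ∞) ≤ {Q ∈ C | tvDist μ Q P ≤ γ}.encard :=
    one_le_encard_iff_nonempty.2 ⟨Q, hQ, hPQ.trans hγ⟩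
  exact_mod_cast h1.trans (ht P hP)

/-! ### From a randomized learner to a deterministic list learner. -/

section ListLearner

variable {X : Type*} [MeasurableSpace X] {μ : Measure X} [SigmaFinite μ] {F C : Set (Measure X)}

/-- Cover elements lie in `F`, so local smallness applies to balls centred at them and forces the
cover to be countable. -/
theorem AdmitsLocallySmallCover.exists_countable [MeasurableSpace.CountablyGenerated X]
    (hF : IsDistributionClass μ F) {t : ℕ} {γ a : ℝ} (hγ : 0 < γ)
    (h : AdmitsLocallySmallCover μ F t γ a) :
    ∃ C : Set (Measure X), C.Countable ∧ IsCover μ F C a ∧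
      ∀ P ∈ F, {Q ∈ C | tvDist μ Q P ≤ γ}.encard ≤ t := by
  obtain ⟨_, C, hC, ht⟩ := h
  refine ⟨C, countable_of_finite_tvDist_le (μ := μ) (fun P hP => ?_) hγ fun P hP => ?_, hC, ht⟩
  · have := (hF P (hC.1 hP)).1
    infer_instance
  · exact encard_lt_top_iff.1 ((ht P (hC.1 hP)).trans_lt (ENat.natCast_lt_top t))

/-- A learner and a locally small cover give a deterministic learner that outputs a short list of
members of the cover, together with a representative of the list. -/
theorem exists_list_learner [MeasurableSpace.CountablyGenerated X]
    (hF : IsDistributionClass μ F) {t m : ℕ} {a b : ℝ} (hCc : C.Countable)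
    (hCne : C.Nonempty) (hC : IsCover μ F C a)
    (hCt : ∀ P ∈ F, {Q ∈ C | tvDist μ Q P ≤ 2 * a}.encard ≤ t)
    {A : Kernel (Fin m → X) F} [IsMarkovKernel A]
    (hA : IsPACLearner μ (fun P : F => (P : Measure X)) a b A) :
    ∃ (S : C → Set (Fin m → X)) (R : (Fin m → X) → C),
      (∀ Q, MeasurableSet (S Q)) ∧ (∀ Q, MeasurableSet (R ⁻¹' {Q})) ∧
      (∀ z, {Q | z ∈ S Q}.encard ≤ (2 * t : ℕ)) ∧
      (∀ z Q, z ∈ S Q → tvDist μ Q (R z) ≤ 4 * a) ∧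
      ∀ f ∈ F, ∃ (Q : C) (G : Set (Fin m → X)), MeasurableSet G ∧
        (Measure.pi fun _ => f) Gᶜ ≤ ENNReal.ofReal (2 * b) ∧
        ∀ z ∈ G, z ∈ S Q ∧ tvDist μ f (R z) ≤ 3 * a := by
  classical
  have := hCc.to_subtype
  have := hCne.to_subtype
  have hpF : ∀ P : F, IsProbabilityMeasure (P : Measure X) := fun P => (hF P P.2).1
  have hpC : ∀ P : C, IsProbabilityMeasure (P : Measure X) := fun P => (hF P (hC.1 P.2)).1
  have hball : ∀ P ∈ F, ∀ r, MeasurableSet {θ : F | tvDist μ P θ ≤ r} := fun P hP r => by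
    have := (hF P hP).1
    exact measurable_tvDist hF (hF P hP).2 measurableSet_Iic
  -- Two events of probability above `1/2` intersect; every distance bound below passes through such
  -- a common output.
  have hint : ∀ {z : Fin m → X} {B B' : Set F}, MeasurableSet B' → 1 / 2 < A z B →
      1 / 2 < A z B' → ∃ θ, θ ∈ B ∧ θ ∈ B' := by
    intro z B B' hB' h h'
    by_contra! hd
    have hle : A z B + A z B' ≤ 1 := by
      rw [← measure_union (disjoint_left.2 hd) hB']
      exact prob_le_one
    refine absurd hle (not_le.2 ?_)
    calc (1 : ℝ≥0∞) = 1 / 2 + 1 / 2 := (ENNReal.add_halves 1).symm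
      _ < _ := ENNReal.add_lt_add h h'
  let B : C → Set F := fun Q => {θ | tvDist μ Q θ ≤ 2 * a}
  have hB : ∀ Q, MeasurableSet (B Q) := fun Q => hball Q (hC.1 Q.2) _
  let S : C → Set (Fin m → X) := fun Q => {z | 1 / 2 < A z (B Q)}
  have hS : ∀ Q, MeasurableSet (S Q) := fun Q =>
    measurableSet_lt measurable_const (A.measurable_coe (hB Q))
  obtain ⟨u, hu⟩ := exists_surjective_nat C
  -- The representative is the first listed element in the enumeration `u`; the second alternative
  -- makes it `u 0` when the list is empty.
  let p : (Fin m → X) → ℕ → Prop := fun z n => z ∈ S (u n) ∨ ∀ k, z ∉ S (u k)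
  have hp : ∀ z, ∃ n, p z n := fun z => by
    by_cases h : ∃ k, z ∈ S (u k)
    · exact h.imp fun k hk => .inl hk
    · exact ⟨0, .inr (not_exists.1 h)⟩
  have hpm : ∀ n, MeasurableSet {z | p z n} := fun n => by
    have : {z | p z n} = S (u n) ∪ ⋂ k, (S (u k))ᶜ := by
      ext z
      simp [p]
    rw [this]
    exact (hS _).union (MeasurableSet.iInter fun k => (hS _).compl)
  let R : (Fin m → X) → C := fun z => u (Nat.find (hp z))
  have hR : ∀ z Q, z ∈ S Q → z ∈ S (R z) := by
    intro z Q hz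
    obtain ⟨k, rfl⟩ := hu Q
    exact (Nat.find_spec (hp z)).resolve_right fun h => h k hz
  refine ⟨S, R, hS, fun Q => ?_, fun z => ?_, fun z Q hz => ?_, fun f hf => ?_⟩
  · exact measurable_find hp hpm (MeasurableSet.of_discrete (s := u ⁻¹' {Q}))
  -- Double counting: every output `θ` lies in at most `t` of the balls, so their masses sum to at
  -- most `t`, while each listed ball has mass at least `1/2`.
  · have hle : ({Q | z ∈ S Q}.encard : ℝ≥0∞) * (1 / 2) ≤ t := by
      calc ({Q | z ∈ S Q}.encard : ℝ≥0∞) * (1 / 2)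
          = ∑' Q, {Q | z ∈ S Q}.indicator (fun _ => 1 / 2) Q := by
            rw [tsum_indicator_const, mul_comm]
        _ ≤ ∑' Q, A z (B Q) := ENNReal.tsum_le_tsum fun Q => by
            by_cases h : z ∈ S Q
            · rw [indicator_of_mem (show Q ∈ {Q | z ∈ S Q} from h)]
              exact le_of_lt h
            · rw [indicator_of_notMem (show Q ∉ {Q | z ∈ S Q} from h)]
              exact zero_le
        _ = ∫⁻ θ, ∑' Q, (B Q).indicator 1 θ ∂(A z) := by
            rw [lintegral_tsum fun Q => (measurable_one.indicator (hB Q)).aemeasurable]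
            simp_rw [lintegral_indicator_one (hB _)]
        _ ≤ ∫⁻ _, t ∂(A z) := by
            refine lintegral_mono fun θ => ?_
            have h1 : ∑' Q, (B Q).indicator (1 : F → ℝ≥0∞) θ
                = ∑' Q, {Q | θ ∈ B Q}.indicator (fun _ => 1) Q := by
              refine tsum_congr fun Q => ?_
              by_cases h : θ ∈ B Q
              · rw [indicator_of_mem h, indicator_of_mem (show Q ∈ {Q | θ ∈ B Q} from h)]
                rfl
              · rw [indicator_of_notMem h, indicator_of_notMem (show Q ∉ {Q | θ ∈ B Q} from h)]
            rw [h1, tsum_indicator_const, one_mul]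
            have h2 : {Q : C | θ ∈ B Q}.encard ≤ t := by
              rw [← Subtype.val_injective.encard_image]
              refine (encard_le_encard ?_).trans (hCt θ θ.2)
              rintro _ ⟨Q, hQ, rfl⟩
              exact ⟨Q.2, hQ⟩
            simpa using ENat.toENNReal_le.2 h2
        _ = t := by simp
    have h2 : ({Q | z ∈ S Q}.encard : ℝ≥0∞) ≤ (2 * t : ℕ) := by
      rw [mul_one_div, ENNReal.div_le_iff two_ne_zero ENNReal.ofNat_ne_top] at hle
      push_cast
      rwa [mul_comm]
    rw [← ENat.toENNReal_le]
    exact_mod_cast h2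
  · obtain ⟨θ, h1, h2⟩ := hint (hB _) hz (hR z Q hz)
    have h3 := tvDist_triangle (μ := μ) Q θ (R z)
    rw [tvDist_comm (θ : Measure X)] at h3
    have h1' : tvDist μ Q θ ≤ 2 * a := h1
    have h2' : tvDist μ (R z) θ ≤ 2 * a := h2
    linarith
  · have := (hF f hf).1
    obtain ⟨Q, hQC, hQ⟩ := hC.2 f hf
    have hQF := (hF Q (hC.1 hQC)).1
    set B' : Set F := {θ | tvDist μ f θ ≤ a}
    have hB' : MeasurableSet B' := hball f hf a
    refine ⟨⟨Q, hQC⟩, {z | 1 / 2 < A z B'},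
      measurableSet_lt measurable_const (A.measurable_coe hB'), ?_, fun z hz => ?_⟩
    · have h1 := hA ⟨f, hf⟩
      have h2 : ((Measure.pi fun _ : Fin m => f).bind A) B'ᶜ ≤ ENNReal.ofReal b := by
        rw [prob_compl_eq_one_sub hB', tsub_le_iff_right, ← ENNReal.ofReal_one]
        calc ENNReal.ofReal 1 = ENNReal.ofReal (b + (1 - b)) := by ring_nf
          _ ≤ _ := ENNReal.ofReal_add_le.trans (add_le_add_right h1 _)
      rw [Measure.bind_apply hB'.compl A.aemeasurable] at h2
      -- Markov's inequality, at the cost of a factor 2: the inputs on which the learner fails with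
      -- probability at least `1/2` are rare.
      have h3 := (mul_meas_ge_le_lintegral (μ := Measure.pi fun _ : Fin m => f)
        (A.measurable_coe hB'.compl) (1 / 2)).trans h2
      have h4 : {z | 1 / 2 < A z B'}ᶜ ⊆ {z | 1 / 2 ≤ A z B'ᶜ} := by
        intro z hz
        have hz' : A z B' ≤ 1 / 2 := not_lt.1 hz
        rw [mem_ofPred_eq, prob_compl_eq_one_sub hB']
        calc (1 : ℝ≥0∞) / 2 = 1 - 1 / 2 := by simp
          _ ≤ _ := tsub_le_tsub_left hz' 1
      rw [ENNReal.ofReal_mul two_pos.le]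
      calc _ ≤ (Measure.pi fun _ : Fin m => f) {z | 1 / 2 ≤ A z B'ᶜ} := measure_mono h4
        _ = 2 * (1 / 2 * (Measure.pi fun _ : Fin m => f) {z | 1 / 2 ≤ A z B'ᶜ}) := by
            rw [← mul_assoc, mul_one_div, ENNReal.div_self two_ne_zero ENNReal.ofNat_ne_top,
              one_mul]
        _ ≤ 2 * ENNReal.ofReal b := by gcongr
        _ = _ := by simp
    · have hzQ : z ∈ S ⟨Q, hQC⟩ := by
        refine lt_of_lt_of_le hz (measure_mono fun θ hθ => ?_)
        have h3 := tvDist_triangle (μ := μ) Q f θ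
        have hθ' : tvDist μ f θ ≤ a := hθ
        rw [tvDist_comm] at hQ
        exact (by linarith : tvDist μ Q θ ≤ 2 * a)
      refine ⟨hzQ, ?_⟩
      obtain ⟨θ, h1, h2⟩ := hint (hB _) hz (hR z _ hzQ)
      have h3 := tvDist_triangle (μ := μ) f θ (R z)
      rw [tvDist_comm (θ : Measure X)] at h3
      have h1' : tvDist μ f θ ≤ a := h1
      have h2' : tvDist μ (R z) θ ≤ 2 * a := h2
      linarith

end ListLearner

end PrivateMixtures

/-! ### Mixtures and the grid of weights. -/

namespace PrivateMixtures

open Set Filter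
open scoped ENNReal

section Mixtures

variable {X : Type*} [MeasurableSpace X] {μ : Measure X} {F : Set (Measure X)} {k : ℕ}

theorem KMix.isProbabilityMeasure_toMeasure (hF : IsDistributionClass μ F) (g : KMix k F) :
    IsProbabilityMeasure g.toMeasure := by
  refine ⟨?_⟩
  have h : ∀ i, (g.2 i : Measure X) univ = 1 := fun i => (hF _ (g.2 i).2).1.measure_univ
  simp only [KMix.toMeasure, Measure.finsetSum_apply, Measure.smul_apply, h, smul_eq_mul, mul_one]
  rw [← ENNReal.ofReal_sum_of_nonneg fun i _ => g.1.2.1 i, g.1.2.2, ENNReal.ofReal_one]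

theorem KMix.toMeasure_absolutelyContinuous (hF : IsDistributionClass μ F) (g : KMix k F) :
    g.toMeasure ≪ μ :=
  Finset.sum_induction _ (fun ρ => ρ ≪ μ) (fun _ _ ha hb => ha.add_left hb)
    (Measure.AbsolutelyContinuous.zero μ) fun i _ => (hF _ (g.2 i).2).2.smul_left _

/-- Components to which `g'` gives weight zero are unconstrained, so those too light to be sampled
may be replaced by anything. -/
theorem KMix.tvDist_le [SigmaFinite μ] (hF : IsDistributionClass μ F) (g g' : KMix k F) {a b : ℝ}
    (ha : ∀ i, g.1.1 i - g'.1.1 i ≤ a) (ha0 : 0 ≤ a)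
    (hb : ∀ i, g'.1.1 i ≠ 0 → tvDist μ (g.2 i) (g'.2 i) ≤ b) :
    tvDist μ g.toMeasure g'.toMeasure ≤ k * a + b := by
  have := g.isProbabilityMeasure_toMeasure hF
  have := g'.isProbabilityMeasure_toMeasure hF
  have : IsProbabilityMeasure (∑ i, ENNReal.ofReal (g.1.1 i) • (g.2 i : Measure X)) :=
    g.isProbabilityMeasure_toMeasure hF
  have : IsProbabilityMeasure (∑ i, ENNReal.ofReal (g'.1.1 i) • (g'.2 i : Measure X)) :=
    g'.isProbabilityMeasure_toMeasure hF
  refine (tvDist_sum_smul_le (μ := μ) g.1.2.1 g'.1.2.1 (fun i => hF _ (g.2 i).2)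
    (fun i => hF _ (g'.2 i).2) ha ha0).trans ?_
  rw [Fintype.card_fin]
  gcongr
  calc ∑ i, g'.1.1 i * tvDist μ (g.2 i) (g'.2 i) ≤ ∑ i, g'.1.1 i * b := by
        refine Finset.sum_le_sum fun i _ => ?_
        by_cases h : g'.1.1 i = 0
        · simp [h]
        · exact mul_le_mul_of_nonneg_left (hb i h) (g'.1.2.1 i)
    _ = b := by rw [← Finset.sum_mul, g'.1.2.2, one_mul]

/-- The weight vectors with entries in `{0, 1 / M, …, 1}`, in units of `1 / M`. -/
abbrev WeightGrid (k M : ℕ) : Type := {a : Fin k → Fin (M + 1) // ∑ i, (a i : ℕ) = M}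

theorem WeightGrid.card_le (k M : ℕ) : Fintype.card (WeightGrid k M) ≤ (M + 1) ^ k :=
  (Fintype.card_subtype_le _).trans_eq (by simp)

/-- The point of the simplex that belongs to a point of the grid. -/
noncomputable def WeightGrid.weight {M : ℕ} (hM : 0 < M) (a : WeightGrid k M) :
    stdSimplex ℝ (Fin k) :=
  ⟨fun i => (a.1 i : ℕ) / M, fun i => by positivity, by
    have hM' : (M : ℝ) ≠ 0 := by positivity
    have h : ((∑ i, (a.1 i : ℕ) : ℕ) : ℝ) = M := by rw [a.2]
    rw [← Finset.sum_div, ← Nat.cast_sum, h, div_self hM']⟩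

/-- Round every weight down and give the whole deficit to one index `i₀` of weight at least `1 / M`,
which exists as `k ≤ M`. The overshoot at `i₀` is harmless because the bound is one-sided, and no
component lighter than `1 / M` gets positive weight. -/
theorem WeightGrid.exists_near {M : ℕ} (hM : 0 < M) (hk : 1 ≤ k) (hkM : k ≤ M)
    (w : stdSimplex ℝ (Fin k)) : ∃ a : WeightGrid k M,
      (∀ i, w.1 i - (a.weight hM).1 i ≤ 1 / M) ∧
      ∀ i, (a.weight hM).1 i ≠ 0 → (1 : ℝ) / M ≤ w.1 i := by
  have hM' : (0 : ℝ) < M := by positivity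
  have hk' : (0 : ℝ) < k := by exact_mod_cast hk
  let u : Fin k → ℕ := fun i => ⌊M * w.1 i⌋₊
  have hu : ∀ i, (u i : ℝ) ≤ M * w.1 i := fun i =>
    Nat.floor_le (mul_nonneg hM'.le (w.2.1 i))
  have hu' : ∀ i, M * w.1 i < u i + 1 := fun i => Nat.lt_floor_add_one _
  have hsum : ∑ i, u i ≤ M := by
    have : ((∑ i, u i : ℕ) : ℝ) ≤ M := by
      push_cast
      calc ∑ i, (u i : ℝ) ≤ ∑ i, M * w.1 i := Finset.sum_le_sum fun i _ => hu i
        _ = M := by rw [← Finset.mul_sum, w.2.2, mul_one]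
    exact_mod_cast this
  obtain ⟨i₀, hi₀⟩ : ∃ i, (1 : ℝ) / M ≤ w.1 i := by
    by_contra! h
    have : ∑ i, w.1 i < ∑ _ : Fin k, (1 : ℝ) / M :=
      Finset.sum_lt_sum_of_nonempty ⟨⟨0, hk⟩, Finset.mem_univ _⟩ fun i _ => h i
    rw [w.2.2, Finset.sum_const, Finset.card_univ, Fintype.card_fin, nsmul_eq_mul, mul_one_div,
      lt_div_iff₀ hM', one_mul] at this
    exact absurd (by exact_mod_cast hkM) (not_le.2 this)
  let a : Fin k → ℕ := fun i => u i + if i = i₀ then M - ∑ i, u i else 0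
  have hau : ∀ i, u i ≤ a i := fun i => Nat.le_add_right _ _
  have ha : ∑ i, a i = M := by
    simp only [a, Finset.sum_add_distrib, Finset.sum_ite_eq', Finset.mem_univ, if_true]
    lia
  have haM : ∀ i, a i < M + 1 := fun i =>
    Nat.lt_succ_of_le ((Finset.single_le_sum (f := a) (fun _ _ => Nat.zero_le _)
      (Finset.mem_univ i)).trans_eq ha)
  refine ⟨⟨fun i => ⟨a i, haM i⟩, ha⟩, fun i => ?_, fun i hi => ?_⟩
  · have h1 : (u i : ℝ) ≤ a i := by exact_mod_cast hau i
    have h2 := hu' i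
    simp only [WeightGrid.weight]
    rw [sub_le_iff_le_add, ← add_div, le_div_iff₀ hM']
    linarith
  · by_cases h : i = i₀
    · exact h ▸ hi₀
    · have hne : u i ≠ 0 := by
        intro h0
        apply hi
        simp [WeightGrid.weight, a, h, h0]
      have h1 : (1 : ℝ) ≤ u i := by exact_mod_cast Nat.one_le_iff_ne_zero.2 hne
      rw [div_le_iff₀ hM']
      linarith [hu i]

end Mixtures

/-! ### The candidates proposed by one batch. -/

section Batch

variable {X : Type*} [MeasurableSpace X] {μ : Measure X} {F C : Set (Measure X)} {k M : ℕ}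

/-- A mixture with weights in the grid and with components in `C`. -/
noncomputable def gridMix (hM : 0 < M) (hCF : C ⊆ F) (h : WeightGrid k M × (Fin k → C)) :
    KMix k F :=
  (h.1.weight hM, fun i => ⟨h.2 i, hCF (h.2 i).2⟩)

/-- The names of the runs of a learner on a batch of `r` blocks of `s` samples: it is run on all
`m`-tuples of entries of a block; the additional `none` stands for a default output. -/
abbrev RunIndex (r s m : ℕ) : Type := Option (Fin r × (Fin m → Fin s))

variable {r s s' m : ℕ}

/-- The representatives of the outputs of the runs of a list learner on a batch. -/
def runRep (R : (Fin m → X) → C) (Q₀ : C) (y : Fin r → Fin s → X) : RunIndex r s m → C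
  | none => Q₀
  | some (i, j) => R (y i ∘ j)

/-- The output lists of the runs of a list learner on a batch. -/
def runList (S : C → Set (Fin m → X)) (Q₀ : C) (y : Fin r → Fin s → X) :
    RunIndex r s m → Set C
  | none => {Q₀}
  | some (i, j) => {Q | y i ∘ j ∈ S Q}

/-- The names of the mixtures of representatives. -/
abbrev MixIndex (k M r s m : ℕ) : Type := WeightGrid k M × (Fin k → RunIndex r s m)

theorem card_mixIndex_le (k M r s m : ℕ) :
    Fintype.card (MixIndex k M r s m) ≤ ((M + 1) * (r * s ^ m + 1)) ^ k := by
  rw [Fintype.card_prod, mul_pow]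
  refine Nat.mul_le_mul (WeightGrid.card_le k M) (le_of_eq ?_)
  simp

variable (μ)

/-- The mixture of representatives named by `ξ`. -/
noncomputable def repMix (hM : 0 < M) (hCF : C ⊆ F) (v : RunIndex r s m → C)
    (ξ : MixIndex k M r s m) : KMix k F :=
  gridMix hM hCF (ξ.1, v ∘ ξ.2)

/-- The sets on which mixtures of representatives are compared. -/
def testSet (hM : 0 < M) (hCF : C ⊆ F) (v : RunIndex r s m → C)
    (x : MixIndex k M r s m × MixIndex k M r s m) : Set X :=
  scheffeSet μ (repMix hM hCF v x.1).toMeasure (repMix hM hCF v x.2).toMeasure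

/-- The test whether a mixture of representatives fits the sample `z` up to `η`. -/
def FitsSample (hM : 0 < M) (hCF : C ⊆ F) (η : ℝ) (v : RunIndex r s m → C)
    (ξ : MixIndex k M r s m) (z : Fin s' → X) : Prop :=
  ∀ x : MixIndex k M r s m × MixIndex k M r s m,
    |(repMix hM hCF v ξ).toMeasure.real (testSet μ hM hCF v x)
    - empirical z (testSet μ hM hCF v x)| ≤ η

/-- The batches for which the mixture `h` is a candidate. -/
def candidateSet (hM : 0 < M) (hCF : C ⊆ F) (η : ℝ) (S : C → Set (Fin m → X))
    (R : (Fin m → X) → C) (Q₀ : C) (h : WeightGrid k M × (Fin k → C)) :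
    Set ((Fin r → Fin s → X) × (Fin s' → X)) :=
  {p | ∃ ξ : MixIndex k M r s m, FitsSample μ hM hCF η (runRep R Q₀ p.1) ξ p.2 ∧
    h.1 = ξ.1 ∧ ∀ i, h.2 i ∈ runList S Q₀ p.1 (ξ.2 i)}

variable {μ} {S : C → Set (Fin m → X)} {R : (Fin m → X) → C} {Q₀ : C} {hM : 0 < M} {hCF : C ⊆ F}

theorem measurable_runIndex (i : Fin r) (j : Fin m → Fin s) :
    Measurable fun y : Fin r → Fin s → X => y i ∘ j :=
  measurable_pi_lambda _ fun l => (measurable_pi_apply (j l)).comp (measurable_pi_apply i)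

theorem measurableSet_runRep_eq [Countable C] (hR : ∀ Q, MeasurableSet (R ⁻¹' {Q}))
    (v : RunIndex r s m → C) :
    MeasurableSet {y : Fin r → Fin s → X | runRep R Q₀ y = v} := by
  simp_rw [funext_iff, ofPred_forall]
  refine MeasurableSet.iInter fun o => ?_
  match o with
  | none => exact MeasurableSet.const (Q₀ = v none)
  | some (i, j) => exact measurable_runIndex i j (hR (v (some (i, j))))

/-- The vector of representatives takes countably many values, so the set is a countable union of
rectangles. -/
theorem measurableSet_fst_snd [Countable C] (hR : ∀ Q, MeasurableSet (R ⁻¹' {Q}))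
    {p : (RunIndex r s m → C) → (Fin s' → X) → Prop} (hp : ∀ v, MeasurableSet {z | p v z}) :
    MeasurableSet {x : (Fin r → Fin s → X) × (Fin s' → X) | p (runRep R Q₀ x.1) x.2} := by
  have : {x : (Fin r → Fin s → X) × (Fin s' → X) | p (runRep R Q₀ x.1) x.2}
      = ⋃ v, {y | runRep R Q₀ y = v} ×ˢ {z | p v z} := by
    ext x
    simp
  rw [this]
  exact MeasurableSet.iUnion fun v => (measurableSet_runRep_eq hR v).prod (hp v)

theorem measurableSet_candidateSet [Countable C] (hS : ∀ Q, MeasurableSet (S Q))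
    (hR : ∀ Q, MeasurableSet (R ⁻¹' {Q})) {η : ℝ} (h : WeightGrid k M × (Fin k → C)) :
    MeasurableSet (candidateSet μ hM hCF η S R Q₀ h :
      Set ((Fin r → Fin s → X) × (Fin s' → X))) := by
  rw [candidateSet, ofPred_exists]
  refine MeasurableSet.iUnion fun ξ => ?_
  simp_rw [ofPred_and]
  refine MeasurableSet.inter (measurableSet_fst_snd hR
    (p := fun v z => FitsSample μ hM hCF η v ξ z) fun v => ?_)
    (MeasurableSet.inter (MeasurableSet.const _) ?_)
  · simp_rw [FitsSample, ofPred_forall]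
    refine MeasurableSet.iInter fun x => measurableSet_le ?_ measurable_const
    exact (measurable_const.sub (measurable_empirical (measurableSet_scheffeSet _ _))).abs
  · rw [ofPred_forall]
    refine MeasurableSet.iInter fun i => ?_
    match ξ.2 i with
    | none => exact MeasurableSet.const (h.2 i = Q₀)
    | some (l, j) => exact (measurable_runIndex l j).comp measurable_fst (hS (h.2 i))

theorem encard_runList_le {t : ℕ} (ht : 1 ≤ t) (hSt : ∀ z, {Q | z ∈ S Q}.encard ≤ (2 * t : ℕ))
    (y : Fin r → Fin s → X) (o : RunIndex r s m) : (runList S Q₀ y o).encard ≤ (2 * t : ℕ) := by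
  match o with
  | none =>
    rw [runList, encard_singleton]
    exact_mod_cast (by lia : 1 ≤ 2 * t)
  | some (i, j) => exact hSt _

/-- Each name of a mixture of representatives contributes one grid point and a product of `k` lists
of length at most `2 * t`. -/
theorem encard_candidateSet_le {t : ℕ} (ht : 1 ≤ t)
    (hSt : ∀ z, {Q | z ∈ S Q}.encard ≤ (2 * t : ℕ)) {η : ℝ}
    (p : (Fin r → Fin s → X) × (Fin s' → X)) :
    {h : WeightGrid k M × (Fin k → C) | p ∈ candidateSet μ hM hCF η S R Q₀ h}.encard
      ≤ (((M + 1) * (r * s ^ m + 1)) ^ k * (2 * t) ^ k : ℕ) := by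
  classical
  have hfin : ∀ o : RunIndex r s m, (runList S Q₀ p.1 o).Finite := fun o =>
    encard_lt_top_iff.1 ((encard_runList_le ht hSt p.1 o).trans_lt (ENat.natCast_lt_top _))
  have hcard : ∀ o : RunIndex r s m, (hfin o).toFinset.card ≤ 2 * t := fun o => by
    have h := encard_runList_le ht hSt p.1 (Q₀ := Q₀) o
    rw [(hfin o).encard_eq_coe_toFinset_card] at h
    exact_mod_cast h
  let L : MixIndex k M r s m → Finset (WeightGrid k M × (Fin k → C)) := fun ξ =>
    {ξ.1} ×ˢ Fintype.piFinset fun i => (hfin (ξ.2 i)).toFinset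
  have hsub : {h : WeightGrid k M × (Fin k → C) | p ∈ candidateSet μ hM hCF η S R Q₀ h}
      ⊆ (Finset.univ.biUnion L : Finset _) := by
    rintro h ⟨ξ, -, h1, h2⟩
    simp only [Finset.coe_biUnion, mem_iUnion]
    refine ⟨ξ, Finset.mem_coe.2 (Finset.mem_univ _), ?_⟩
    simpa [L] using ⟨h.2, h2, by rw [← h1]⟩
  refine (encard_le_encard hsub).trans ?_
  rw [encard_coe_eq_coe_finsetCard]
  norm_cast
  refine (Finset.card_biUnion_le_card_mul _ _ ((2 * t) ^ k) fun ξ _ => ?_).trans ?_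
  · rw [Finset.card_product, Finset.card_singleton, one_mul, Fintype.card_piFinset]
    exact (Finset.prod_le_prod' fun i _ => hcard (ξ.2 i)).trans_eq (by simp)
  · exact Nat.mul_le_mul_right _ (card_mixIndex_le k M r s m)

variable [SigmaFinite μ]

/-- On a typical batch, the candidates are close to the truth `g`, and include every mixture with
approximately the right weights and with components in the lists for those of `g`. -/
theorem candidateSet_of_typical (hF : IsDistributionClass μ F) {a e : ℝ} (ha : 0 ≤ a)
    (hSR : ∀ z Q, z ∈ S Q → tvDist μ Q (R z) ≤ 4 * a) {g : KMix k F}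
    {h₀ : WeightGrid k M × (Fin k → C)}
    (hw : ∀ i, g.1.1 i - (h₀.1.weight hM).1 i ≤ 1 / M)
    {p : (Fin r → Fin s → X) × (Fin s' → X)}
    (hlist : ∀ i, ∃ o : RunIndex r s m, h₀.2 i ∈ runList S Q₀ p.1 o ∧
      ((h₀.1.weight hM).1 i ≠ 0 → tvDist μ (g.2 i) (runRep R Q₀ p.1 o) ≤ 3 * a))
    (hemp : ∀ x : MixIndex k M r s m × MixIndex k M r s m,
      |g.toMeasure.real (testSet μ hM hCF (runRep R Q₀ p.1) x)
        - empirical p.2 (testSet μ hM hCF (runRep R Q₀ p.1) x)| < e) :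
    p ∈ candidateSet μ hM hCF (3 * a + k / M + e) S R Q₀ h₀ ∧
      ∀ h : WeightGrid k M × (Fin k → C), p ∈ candidateSet μ hM hCF (3 * a + k / M + e) S R Q₀ h →
        tvDist μ g.toMeasure (gridMix hM hCF h).toMeasure ≤ 13 * a + 3 * (k / M) + 2 * e := by
  have hprob := KMix.isProbabilityMeasure_toMeasure (k := k) hF
  have hac := KMix.toMeasure_absolutelyContinuous (k := k) hF
  have hmeas : ∀ x : MixIndex k M r s m × MixIndex k M r s m,
      MeasurableSet (testSet μ hM hCF (runRep R Q₀ p.1) x) :=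
    fun x => measurableSet_scheffeSet _ _
  choose o ho1 ho2 using hlist
  set v := runRep R Q₀ p.1
  set ξ₀ : MixIndex k M r s m := (h₀.1, o)
  have h1 : tvDist μ g.toMeasure (repMix hM hCF v ξ₀).toMeasure ≤ k / M + 3 * a := by
    refine (KMix.tvDist_le hF g (repMix hM hCF v ξ₀) (a := 1 / M) hw (by positivity)
      ho2).trans_eq ?_
    ring
  have hfit : FitsSample μ hM hCF (3 * a + k / M + e) v ξ₀ p.2 := by
    intro x
    have h2 := abs_real_sub_real_le_tvDist (hac g) (hac (repMix hM hCF v ξ₀)) (hmeas x)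
    have h3 := hemp x
    rw [abs_sub_comm] at h2
    have h4 := abs_sub_le ((repMix hM hCF v ξ₀).toMeasure.real (testSet μ hM hCF v x))
      (g.toMeasure.real (testSet μ hM hCF v x)) (empirical p.2 (testSet μ hM hCF v x))
    linarith
  refine ⟨⟨ξ₀, hfit, rfl, ho1⟩, ?_⟩
  rintro h ⟨ξ, hξ, hh1, hh2⟩
  -- A candidate has the weights of its mixture of representatives, and each component is within `4
  -- * a` of its representative.
  have h5 : tvDist μ (repMix hM hCF v ξ).toMeasure (gridMix hM hCF h).toMeasure ≤ 4 * a := by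
    refine (KMix.tvDist_le hF (repMix hM hCF v ξ) (gridMix hM hCF h) (a := 0) (b := 4 * a)
      (fun i => ?_) le_rfl fun i _ => ?_).trans_eq (by ring)
    · simp [repMix, gridMix, hh1]
    · change tvDist μ (v (ξ.2 i)) (h.2 i) ≤ 4 * a
      rw [tvDist_comm]
      have hi := hh2 i
      generalize ξ.2 i = o' at hi
      match o', hi with
      | none, hi =>
        rw [show h.2 i = Q₀ from hi, show v none = Q₀ from rfl, tvDist_self]
        positivity
      | some (l, j), hi => exact hSR _ _ hi
  -- The distance is read off on the Scheffé set of this pair, itself a test set: from `ξ₀` to `g`,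
  -- to the empirical measure, to `ξ`.
  have h6 : tvDist μ (repMix hM hCF v ξ₀).toMeasure (repMix hM hCF v ξ).toMeasure
      ≤ (3 * a + k / M + e) + e + (k / M + 3 * a) := by
    rw [tvDist_eq_scheffeSet (hac _) (hac _)]
    have h7 := abs_le.1 (hξ (ξ₀, ξ))
    have h8 := abs_lt.1 (hemp (ξ₀, ξ))
    have h9 := real_sub_real_le_tvDist (hac (repMix hM hCF v ξ₀)) (hac g) (hmeas (ξ₀, ξ))
    rw [tvDist_comm] at h9
    change _ - (repMix hM hCF v ξ).toMeasure.real (testSet μ hM hCF v (ξ₀, ξ)) ≤ _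
    change (repMix hM hCF v ξ₀).toMeasure.real (testSet μ hM hCF v (ξ₀, ξ)) - _ ≤ _
    linarith [h7.1, h8.2]
  have h10 := tvDist_triangle (μ := μ) g.toMeasure (repMix hM hCF v ξ₀).toMeasure
    (gridMix hM hCF h).toMeasure
  have h11 := tvDist_triangle (μ := μ) (repMix hM hCF v ξ₀).toMeasure
    (repMix hM hCF v ξ).toMeasure (gridMix hM hCF h).toMeasure
  linarith

end Batch

end PrivateMixtures

/-! ### The private learner for mixtures. -/

namespace PrivateMixtures

open Set Filter
open scoped ENNReal

section MixtureLearning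

variable {X : Type*} [MeasurableSpace X] {μ : Measure X} {F C : Set (Measure X)} {k M : ℕ}
  {r s s' m : ℕ}

/-- A sample of a mixture contains, in one of `r` blocks, an `m`-tuple that is typical of a
component of weight at least `1 / M`. -/
theorem measure_no_tuple_blocks_le (hF : IsDistributionClass μ F) (g : KMix k F) (hM : 0 < M)
    {i : Fin k} (hi : (1 : ℝ) / M ≤ g.1.1 i) {G : Set (Fin m → X)} (hG : MeasurableSet G) {b : ℝ}
    (hb : 0 ≤ b) (hGb : (Measure.pi fun _ => (g.2 i : Measure X)) Gᶜ ≤ ENNReal.ofReal b) :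
    (Measure.pi fun _ : Fin r => Measure.pi fun _ : Fin s => g.toMeasure)
        {y | ∀ l, ∀ j : Fin m → Fin s, y l ∘ j ∉ G}
      ≤ ENNReal.ofReal ((b + 2 ^ m * (1 - 1 / (2 * M)) ^ s) ^ r) := by
  have hP := g.isProbabilityMeasure_toMeasure hF
  have hf := (hF _ (g.2 i).2).1
  have hM' : (1 : ℝ) ≤ M := by exact_mod_cast hM
  have hw0 := g.1.2.1 i
  have hw1 : g.1.1 i ≤ 1 := by
    rw [← g.1.2.2]
    exact Finset.single_le_sum (f := g.1.1) (fun j _ => g.1.2.1 j) (Finset.mem_univ i)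
  have hMhalf : (1 : ℝ) / (2 * M) = 1 / M / 2 := by rw [div_div, mul_comm]
  let ν : Measure X := ∑ j ∈ Finset.univ.erase i, ENNReal.ofReal (g.1.1 j) • (g.2 j : Measure X)
  have hPν : g.toMeasure = ENNReal.ofReal (g.1.1 i) • (g.2 i : Measure X) + ν :=
    (Finset.add_sum_erase _ _ (Finset.mem_univ i)).symm
  have hν : ν univ = ENNReal.ofReal (1 - g.1.1 i) := by
    have h : ∀ j, (g.2 j : Measure X) univ = 1 := fun j => (hF _ (g.2 j).2).1.measure_univ
    simp only [ν, Measure.finsetSum_apply, Measure.smul_apply, h, smul_eq_mul, mul_one]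
    rw [← ENNReal.ofReal_sum_of_nonneg fun j _ => g.1.2.1 j, ← g.1.2.2,
      ← Finset.add_sum_erase _ g.1.1 (Finset.mem_univ i), add_sub_cancel_left]
  have hblock := measure_no_tuple_le (P := g.toMeasure) (f := g.2 i)
    (ρ := ENNReal.ofReal (1 - g.1.1 i / 2)) ?_ ?_ hPν hν s m G hG
  -- Failure in all blocks is a product event, whence the power `r`.
  · have hset : {y : Fin r → Fin s → X | ∀ l, ∀ j : Fin m → Fin s, y l ∘ j ∉ G}
        = univ.pi fun _ => {y | ∀ j : Fin m → Fin s, y ∘ j ∉ G} := by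
      ext y
      simp
    rw [hset, Measure.pi_pi, Finset.prod_const, Finset.card_univ, Fintype.card_fin]
    have hρ : (0 : ℝ) ≤ 1 - 1 / (2 * M) := by
      rw [hMhalf]
      linarith [(div_le_one (by positivity)).2 hM']
    rw [ENNReal.ofReal_pow (by positivity), ENNReal.ofReal_add hb (by positivity),
      ENNReal.ofReal_mul (by positivity), ENNReal.ofReal_pow two_pos.le, ENNReal.ofReal_pow hρ,
      ENNReal.ofReal_ofNat]
    have hw : 1 - g.1.1 i / 2 ≤ 1 - 1 / (2 * M) := by
      rw [hMhalf]
      linarith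
    refine pow_le_pow_left' (hblock.trans ?_) r
    gcongr
  · rw [← ENNReal.ofReal_add hw0 (by linarith), add_sub_cancel, ENNReal.ofReal_one]
  · rw [← ENNReal.ofReal_ofNat 2, ← ENNReal.ofReal_mul two_pos.le, ← ENNReal.ofReal_mul two_pos.le,
      ← ENNReal.ofReal_add hw0 (by linarith)]
    congr 1
    ring

variable [SigmaFinite μ] {S : C → Set (Fin m → X)} {R : (Fin m → X) → C}

/-- A batch of samples of a mixture is typical with high probability. -/
theorem exists_candidate_measure_le [Countable C] (hF : IsDistributionClass μ F) (hk : 1 ≤ k)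
    (hkM : k ≤ M) (hM : 0 < M) (hCF : C ⊆ F) (hs' : 0 < s') {a b e : ℝ} (ha : 0 ≤ a) (hb : 0 ≤ b)
    (he : 0 ≤ e) (Q₀ : C) (hR : ∀ Q, MeasurableSet (R ⁻¹' {Q}))
    (hSR : ∀ z Q, z ∈ S Q → tvDist μ Q (R z) ≤ 4 * a)
    (hlearn : ∀ f ∈ F, ∃ (Q : C) (G : Set (Fin m → X)), MeasurableSet G ∧
        (Measure.pi fun _ => f) Gᶜ ≤ ENNReal.ofReal b ∧
        ∀ z ∈ G, z ∈ S Q ∧ tvDist μ f (R z) ≤ 3 * a) (g : KMix k F) :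
    ∃ h₀ : WeightGrid k M × (Fin k → C),
      ((Measure.pi fun _ : Fin r => Measure.pi fun _ : Fin s => g.toMeasure).prod
          (Measure.pi fun _ : Fin s' => g.toMeasure))
        {p | p ∈ candidateSet μ hM hCF (3 * a + k / M + e) S R Q₀ h₀ ∧
          ∀ h : WeightGrid k M × (Fin k → C),
            p ∈ candidateSet μ hM hCF (3 * a + k / M + e) S R Q₀ h →
              tvDist μ g.toMeasure (gridMix hM hCF h).toMeasure
                ≤ 13 * a + 3 * (k / M) + 2 * e}ᶜ
      ≤ ENNReal.ofReal (k * (b + 2 ^ m * (1 - 1 / (2 * M)) ^ s) ^ r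
        + 2 * (((M + 1) * (r * s ^ m + 1)) ^ k : ℕ) ^ 2 * Real.exp (-(2 * s' * e ^ 2))) := by
  classical
  have hP := g.isProbabilityMeasure_toMeasure hF
  have hM' : (1 : ℝ) ≤ M := by exact_mod_cast hM
  have hρ : (0 : ℝ) ≤ 1 - 1 / (2 * M) := by
    rw [sub_nonneg, div_le_one (by positivity)]
    linarith
  obtain ⟨w, hw, hw'⟩ := WeightGrid.exists_near hM hk hkM g.1
  choose Q G hG hGb hGQ using fun i => hlearn (g.2 i) (g.2 i).2
  -- This mixture depends on `g` and not on the batch, so all batches can agree on it. At weight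
  -- zero it uses `Q₀`, which the run `none` lists on every batch.
  let h₀ : WeightGrid k M × (Fin k → C) :=
    (w, fun i => if (w.weight hM).1 i = 0 then Q₀ else Q i)
  refine ⟨h₀, ?_⟩
  set ν := Measure.pi fun _ : Fin r => Measure.pi fun _ : Fin s => g.toMeasure
  set ν' := Measure.pi fun _ : Fin s' => g.toMeasure
  let bad : Fin k → Set (Fin r → Fin s → X) := fun i =>
    {y | (w.weight hM).1 i ≠ 0 ∧ ∀ l, ∀ j : Fin m → Fin s, y l ∘ j ∉ G i}
  let far : (RunIndex r s m → C) → Set (Fin s' → X) := fun v =>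
    {z | ∃ x : MixIndex k M r s m × MixIndex k M r s m,
      e ≤ |g.toMeasure.real (testSet μ hM hCF v x) - empirical z (testSet μ hM hCF v x)|}
  have htest : ∀ v (x : MixIndex k M r s m × MixIndex k M r s m),
    MeasurableSet (testSet μ hM hCF v x) := fun v x => measurableSet_scheffeSet _ _
  let Bad : Set ((Fin r → Fin s → X) × (Fin s' → X)) := ⋃ i, bad i ×ˢ univ
  let Far : Set ((Fin r → Fin s → X) × (Fin s' → X)) := {p | p.2 ∈ far (runRep R Q₀ p.1)}
  have hsub : {p | p ∈ candidateSet μ hM hCF (3 * a + k / M + e) S R Q₀ h₀ ∧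
      ∀ h : WeightGrid k M × (Fin k → C),
        p ∈ candidateSet μ hM hCF (3 * a + k / M + e) S R Q₀ h →
          tvDist μ g.toMeasure (gridMix hM hCF h).toMeasure
            ≤ 13 * a + 3 * (k / M) + 2 * e}ᶜ ⊆ Bad ∪ Far := by
    intro p hp
    by_contra hcon
    rw [mem_union, not_or] at hcon
    have hlist : ∀ i, ∃ o : RunIndex r s m, h₀.2 i ∈ runList S Q₀ p.1 o ∧
        ((h₀.1.weight hM).1 i ≠ 0 → tvDist μ (g.2 i) (runRep R Q₀ p.1 o) ≤ 3 * a) := by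
      intro i
      by_cases hi : (w.weight hM).1 i = 0
      · exact ⟨none, by simp [h₀, hi, runList], fun h => absurd hi h⟩
      · have h1 : p.1 ∉ bad i := fun h => hcon.1 (mem_iUnion.2 ⟨i, h, mem_univ _⟩)
        have h2 : ∃ l, ∃ j : Fin m → Fin s, p.1 l ∘ j ∈ G i := by
          by_contra! h
          exact h1 ⟨hi, h⟩
        obtain ⟨l, j, hlj⟩ := h2
        refine ⟨some (l, j), ?_, fun _ => (hGQ i _ hlj).2⟩
        simpa [h₀, hi, runList] using (hGQ i _ hlj).1
    refine hp (candidateSet_of_typical (h₀ := h₀) hF ha hSR hw hlist fun x => ?_)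
    by_contra! h
    exact hcon.2 ⟨x, h⟩
  have hBad : (ν.prod ν') Bad
      ≤ ENNReal.ofReal (k * (b + 2 ^ m * (1 - 1 / (2 * M)) ^ s) ^ r) := by
    calc (ν.prod ν') Bad ≤ ∑ i, (ν.prod ν') (bad i ×ˢ univ) := measure_iUnion_fintype_le _ _
      _ ≤ ∑ _ : Fin k, ENNReal.ofReal ((b + 2 ^ m * (1 - 1 / (2 * M)) ^ s) ^ r) := by
        refine Finset.sum_le_sum fun i _ => ?_
        rw [Measure.prod_prod, measure_univ, mul_one]
        by_cases hi : (w.weight hM).1 i = 0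
        · simp [bad, hi]
        · exact (measure_mono fun y hy => hy.2).trans
            (measure_no_tuple_blocks_le hF g hM (hw' i hi) (hG i) hb (hGb i))
      _ = _ := by
        rw [Finset.sum_const, Finset.card_univ, Fintype.card_fin, nsmul_eq_mul,
          ENNReal.ofReal_mul (by positivity), ENNReal.ofReal_natCast]
  have hFarm : MeasurableSet Far := by
    refine measurableSet_fst_snd hR (p := fun v z => z ∈ far v) fun v => ?_
    simp only [far]
    rw [show {z | z ∈ {z : Fin s' → X | ∃ x : MixIndex k M r s m × MixIndex k M r s m,
      e ≤ |g.toMeasure.real (testSet μ hM hCF v x) - empirical z (testSet μ hM hCF v x)|}}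
      = ⋃ x : MixIndex k M r s m × MixIndex k M r s m, {z : Fin s' → X |
      e ≤ |g.toMeasure.real (testSet μ hM hCF v x) - empirical z (testSet μ hM hCF v x)|} by
        ext z; simp]
    exact MeasurableSet.iUnion fun x => measurableSet_le measurable_const
      (measurable_const.sub (measurable_empirical (htest v x))).abs
  have hFar : (ν.prod ν') Far ≤ ENNReal.ofReal
      (2 * (((M + 1) * (r * s ^ m + 1)) ^ k : ℕ) ^ 2 * Real.exp (-(2 * s' * e ^ 2))) := by
    -- By Fubini the blocks may be fixed. The test sets are then fixed, finite in number, and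
    -- independent of the last `s'` samples.
    rw [Measure.prod_apply hFarm]
    refine (lintegral_mono (g := fun _ => ENNReal.ofReal (2 *
      (((M + 1) * (r * s ^ m + 1)) ^ k : ℕ) ^ 2 * Real.exp (-(2 * s' * e ^ 2)))) fun y => ?_).trans
      (by simp)
    refine (measure_empirical_far_le g.toMeasure hs' (htest (runRep R Q₀ y)) he).trans ?_
    refine ENNReal.ofReal_le_ofReal ?_
    gcongr
    rw [Fintype.card_prod, Nat.cast_mul, ← sq]
    gcongr
    exact card_mixIndex_le k M r s m
  refine (measure_mono hsub).trans ((measure_union_le _ _).trans ?_)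
  rw [ENNReal.ofReal_add (by positivity) (by positivity)]
  exact add_le_add hBad hFar

/-- Private learnability of mixtures, with explicit parameters. -/
theorem dpPACLearnable_kMix [MeasurableSpace.CountablyGenerated X] (hF : IsDistributionClass μ F)
    (hne : F.Nonempty) {α β β' ε δ : ℝ} {t T : ℕ} (hα : 0 < α) (hβ : 0 < β) (hβ' : 0 < β')
    (hε : 0 < ε) (hδ : 0 < δ) (hδ1 : δ ≤ 1) (hk : 1 ≤ k)
    (hkM : k ≤ M) (hs' : 0 < s') (ht : 1 ≤ t)
    (hcover : AdmitsLocallySmallCover μ F t (2 * α / 15) (α / 15))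
    (hlearn : PACLearnable μ (fun P : F => (P : Measure X)) (α / 15) β' m)
    (hMα : (k : ℝ) / M ≤ α / 50)
    (hfail : T * (k * (2 * β' + 2 ^ m * (1 - 1 / (2 * M)) ^ s) ^ r
      + 2 * (((M + 1) * (r * s ^ m + 1)) ^ k : ℕ) ^ 2 * Real.exp (-(2 * s' * (α / 30) ^ 2)))
      ≤ β / 2)
    (hT : (((M + 1) * (r * s ^ m + 1)) ^ k * (2 * t) ^ k : ℕ) * Real.exp (ε / 2) / δ
      ≤ β / 2 * Real.exp (ε / 2) ^ T) :
    DPPACLearnable μ (KMix.toMeasure : KMix k F → Measure X) ε δ α β (T * (r * s + s')) := by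
  have hM : 0 < M := by lia
  obtain ⟨C, hCc, hC, hCt⟩ := hcover.exists_countable hF (by positivity)
  obtain ⟨A, hAm, hA⟩ := hlearn
  obtain ⟨P₀, hP₀⟩ := hne
  obtain ⟨Q₀, hQ₀, -⟩ := hC.2 P₀ hP₀
  have := hCc.to_subtype
  have hCF := hC.1
  rw [mul_div_assoc] at hCt
  obtain ⟨S, R, hS, hR, hSt, hSR, hlist⟩ :=
    exists_list_learner hF hCc ⟨Q₀, hQ₀⟩ hC hCt hA
  let e : Fin T × ((Fin r × Fin s) ⊕ Fin s') ≃ Fin (T * (r * s + s')) :=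
    Fintype.equivFinOfCardEq (by simp)
  let φ : Fin T → (Fin (T * (r * s + s')) → X) → (Fin r → Fin s → X) × (Fin s' → X) :=
    fun b D => (fun i l => D (e (b, .inl (i, l))), fun l => D (e (b, .inr l)))
  have hφ : ∀ (P : Measure X) [IsProbabilityMeasure P] (b : Fin T),
      MeasurePreserving (φ b) (Measure.pi fun _ => P)
        ((Measure.pi fun _ => Measure.pi fun _ => P).prod (Measure.pi fun _ => P)) :=
    fun P _ b => measurePreserving_blocks P (e := fun x => e (b, x))
      (e.injective.comp (Prod.mk_right_injective b))
  have hφm : ∀ b, Measurable (φ b) := fun b => by fun_prop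
  have hnb : ∀ D D', Neighbouring D D' → ∃ b₀, ∀ b, b ≠ b₀ → φ b D = φ b D' := by
    rintro D D' ⟨i, hi⟩
    -- The batches use disjoint entries, so one entry affects only its own batch.
    refine ⟨(e.symm i).1, fun b hb => ?_⟩
    have hne : ∀ x, e (b, x) ≠ i := by
      rintro x rfl
      simp at hb
    simp only [φ, hi _ (hne _)]
  set η := 3 * (α / 15) + k / M + α / 30
  let V : WeightGrid k M × (Fin k → C) → Set ((Fin r → Fin s → X) × (Fin s' → X)) :=
    candidateSet μ hM hCF η S R ⟨Q₀, hQ₀⟩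
  have hmax : (0 : ℝ) < β / 2 := by positivity
  obtain ⟨L, hLm, hLdp, hL⟩ := exists_isDP_selection (K := WeightGrid k M × (Fin k → C))
    (V := V) (φ := φ) (Nat.one_le_iff_ne_zero.2 (by positivity))
    (fun h => measurableSet_candidateSet hS hR h)
    (encard_candidateSet_le ht hSt) hφm hnb (gridMix hM hCF)
    (⟨⟨Pi.single ⟨0, hk⟩ 1, single_mem_stdSimplex ℝ _⟩, fun _ => ⟨P₀, hP₀⟩⟩)
    hε hδ hδ1 hmax hT
  refine ⟨L, hLm, hLdp, fun g => ?_⟩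
  have hP := g.isProbabilityMeasure_toMeasure hF
  obtain ⟨h₀, hh₀⟩ := exists_candidate_measure_le (r := r) (s := s) hF hk hkM hM hCF hs'
    (a := α / 15) (b := 2 * β') (e := α / 30) (by positivity) (by positivity) (by positivity)
    ⟨Q₀, hQ₀⟩ hR hSR hlist g
  set E : Set (KMix k F) := {θ' | tvDist μ g.toMeasure θ'.toMeasure ≤ α}
  set good : Set ((Fin r → Fin s → X) × (Fin s' → X)) :=
    {p | p ∈ V h₀ ∧ ∀ h, p ∈ V h → tvDist μ g.toMeasure (gridMix hM hCF h).toMeasure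
      ≤ 13 * (α / 15) + 3 * (k / M) + 2 * (α / 30)} with hgood
  set ν := Measure.pi fun _ : Fin (T * (r * s + s')) => g.toMeasure
  set B : Set (Fin (T * (r * s + s')) → X) := toMeasurable ν (⋃ b, φ b ⁻¹' goodᶜ)
  have hB : ν B ≤ ENNReal.ofReal (β / 2) := by
    rw [measure_toMeasurable]
    calc ν (⋃ b, φ b ⁻¹' goodᶜ) ≤ ∑ b, ν (φ b ⁻¹' goodᶜ) := measure_iUnion_fintype_le _ _
      _ ≤ ∑ _ : Fin T, _ := Finset.sum_le_sum fun b _ =>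
          (measure_preimage_le_of_measurePreserving (hφ _ b) _).trans hh₀
      _ ≤ ENNReal.ofReal (β / 2) := by
          rw [Finset.sum_const, Finset.card_univ, Fintype.card_fin, nsmul_eq_mul,
            ← ENNReal.ofReal_natCast, ← ENNReal.ofReal_mul (by positivity)]
          exact ENNReal.ofReal_le_ofReal hfail
  have hgoodD : ∀ D ∈ Bᶜ, 1 ≤ L D E + ENNReal.ofReal (β / 2) := by
    intro D hD
    have hall : ∀ b, φ b D ∈ good := by
      intro b
      by_contra h
      exact hD (subset_toMeasurable _ _ (mem_iUnion.2 ⟨b, h⟩))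
    refine hL D E h₀ (fun b => (hall b).1) fun b h hb => ?_
    have h1 := (hall b).2 h hb
    -- The error budget: `13/15 + 3/50 + 2/30 < 1`.
    exact (by linarith : tvDist μ g.toMeasure (gridMix hM hCF h).toMeasure ≤ α)
  have hBm : MeasurableSet B := measurableSet_toMeasurable _ _
  have hlow : ENNReal.ofReal (1 - β / 2) * ν Bᶜ ≤ (ν.bind L) E := by
    rw [← measure_toMeasurable E, Measure.bind_apply (measurableSet_toMeasurable _ _) L.aemeasurable,
      ← lintegral_indicator_const hBm.compl]
    refine lintegral_mono fun D => ?_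
    by_cases hD : D ∈ Bᶜ
    · rw [indicator_of_mem hD]
      refine le_trans ?_ (measure_mono (subset_toMeasurable (ν.bind L) E))
      rw [ENNReal.ofReal_sub _ hmax.le, ENNReal.ofReal_one]
      exact tsub_le_iff_right.2 (hgoodD D hD)
    · rw [indicator_of_notMem hD]
      exact zero_le
  refine le_trans ?_ hlow
  have hBc : ENNReal.ofReal (1 - β / 2) ≤ ν Bᶜ := by
    rw [prob_compl_eq_one_sub hBm, ENNReal.ofReal_sub _ hmax.le, ENNReal.ofReal_one]
    exact tsub_le_tsub_left hB 1
  by_cases h2 : β ≤ 1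
  · calc ENNReal.ofReal (1 - β) ≤ ENNReal.ofReal ((1 - β / 2) * (1 - β / 2)) :=
          ENNReal.ofReal_le_ofReal (by nlinarith)
      _ = ENNReal.ofReal (1 - β / 2) * ENNReal.ofReal (1 - β / 2) :=
          ENNReal.ofReal_mul (by linarith)
      _ ≤ _ := by gcongr
  · rw [ENNReal.ofReal_of_nonpos (by linarith)]
    exact zero_le

end MixtureLearning

end PrivateMixtures

/-! ### Choice of the parameters. -/

namespace PrivateMixtures

section Parameters

theorem exists_nat_between {y : ℝ} (hy : 0 ≤ y) : ∃ n : ℕ, y ≤ n ∧ (n : ℝ) ≤ y + 1 :=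
  ⟨⌈y⌉₊, Nat.le_ceil y, (Nat.ceil_lt_add_one hy).le⟩

/-- Pulling out the factor `m` makes `k` times this logarithm at most `m * k` times a logarithm of
the sizes. -/
theorem log_mixIndex_le {M r s m : ℕ} (hr : 1 ≤ r) (hs : 1 ≤ s) (hm : 1 ≤ m) :
    Real.log (((M : ℝ) + 1) * (r * s ^ m + 1)) ≤ m * Real.log ((M + 1) * (2 * r * s)) := by
  have hr' : (1 : ℝ) ≤ r := by exact_mod_cast hr
  have hs' : (1 : ℝ) ≤ s := by exact_mod_cast hs
  rw [← Real.log_pow]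
  refine Real.log_le_log (by positivity) ?_
  have h1 : (1 : ℝ) ≤ r * s ^ m := one_le_mul_of_one_le_of_one_le hr' (one_le_pow₀ hs')
  have h2 : (M : ℝ) + 1 ≤ (M + 1) ^ m := le_self_pow₀ (by linarith [M.cast_nonneg (α := ℝ)]) (by lia)
  have h3 : 2 * (r : ℝ) ≤ (2 * r) ^ m := le_self_pow₀ (by linarith) (by lia)
  calc ((M : ℝ) + 1) * (r * s ^ m + 1) ≤ (M + 1) * (2 * r * s ^ m) := by
        gcongr
        linarith
    _ ≤ (M + 1) ^ m * ((2 * r) ^ m * s ^ m) := by gcongr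
    _ = _ := by simp only [mul_pow]

theorem le_exp_of_le_pow {y : ℝ} (n : ℕ) (h : y ≤ 2.7 ^ n) : y ≤ Real.exp n := by
  refine h.trans ?_
  rw [← Real.exp_one_pow]
  exact pow_le_pow_left₀ (by norm_num) (by linarith [Real.exp_one_gt_d9]) n

/-- A lower bound for the confidence of the learner of the components. -/
theorem two_mul_le_of_soft_le {α β β' ε δ : ℝ} {k m t : ℕ} (hα : 0 < α) (hα1 : α < 1) (hβ : 0 < β)
    (hβ' : 0 < β') (hε : 0 < ε) (hεk : ε ≤ 6 * k) (hδ : 0 < δ) (hδ1 : δ ≤ 1) (hm : 1 ≤ m)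
    (ht : 1 ≤ t)
    (hconf : soft 100 0 (Real.log (1 + m * k * Real.log (1 + t / (α * δ)) / (ε * β)))
      ≤ Real.log (1 / β')) : 2 * β' ≤ β / 4 := by
  have hm' : (1 : ℝ) ≤ m := by exact_mod_cast hm
  have ht' : (1 : ℝ) ≤ t := by exact_mod_cast ht
  set Z := m * k * Real.log (1 + t / (α * δ)) / (ε * β) with hZ
  have h1 : (1 : ℝ) / 2 ≤ Real.log (1 + t / (α * δ)) := by
    have h2 : (1 : ℝ) ≤ t / (α * δ) := by
      rw [le_div_iff₀ (by positivity), one_mul]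
      exact (mul_le_one₀ hα1.le hδ.le hδ1).trans ht'
    calc (1 : ℝ) / 2 ≤ Real.log 2 := by linarith [Real.log_two_gt_d9]
      _ ≤ _ := Real.log_le_log two_pos (by linarith)
  have h3 : 1 / (12 * β) ≤ Z := by
    rw [hZ, div_le_div_iff₀ (by positivity) (by positivity)]
    -- Here `ε ≤ 6 * k` enters, together with the bound `1/2` for the logarithm.
    have h4 : ε ≤ 12 * (m * k * Real.log (1 + t / (α * δ))) := by
      have h5 : (k : ℝ) / 2 ≤ m * k * Real.log (1 + t / (α * δ)) := by
        calc (k : ℝ) / 2 = 1 * k * (1 / 2) := by ring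
          _ ≤ _ := by gcongr
      linarith
    nlinarith
  have hZ0 : 0 ≤ Z := le_trans (by positivity) h3
  have h6 : Real.log ((1 + Z) ^ 100) ≤ Real.log (1 / β') := by
    rw [Real.log_pow]
    simpa [soft] using hconf
  have h7 : (1 + Z) ^ 100 ≤ 1 / β' :=
    (Real.log_le_log_iff (by positivity) (by positivity)).1 h6
  -- Bernoulli's inequality gives `1 / β' ≥ 100 / (12 * β)`, more than the required `8 / β`. A
  -- constant multiple of `β` is enough because the blocks amplify the confidence.
  have h8 : 1 + (100 : ℕ) * Z ≤ (1 + Z) ^ 100 := one_add_mul_le_pow (by linarith) 100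
  have h9 : 100 * (1 / (12 * β)) ≤ 1 / β' := by
    push_cast at h8
    linarith
  rw [mul_one_div, div_le_div_iff₀ (by positivity) hβ'] at h9
  linarith

set_option maxHeartbeats 2000000 in
/-- The parameters of the algorithm. -/
theorem exists_parameters {α β β' ε δ : ℝ} {k m t : ℕ} (hα : 0 < α) (hα1 : α < 1) (hβ : 0 < β)
    (hβ1 : β < 1) (hβ' : 0 < β') (hε : 0 < ε) (hεk : ε ≤ 6 * k) (hδ : 0 < δ) (hδ1 : δ ≤ 1)
    (hk : 1 ≤ k) (hm : 1 ≤ m) (ht : 1 ≤ t) (hββ : 2 * β' ≤ β / 4) :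
    ∃ M r s s' T : ℕ, k ≤ M ∧ 0 < s' ∧ (k : ℝ) / M ≤ α / 50 ∧
      T * (k * (2 * β' + 2 ^ m * (1 - 1 / (2 * M)) ^ s) ^ r
        + 2 * (((M + 1) * (r * s ^ m + 1)) ^ k : ℕ) ^ 2 * Real.exp (-(2 * s' * (α / 30) ^ 2)))
        ≤ β / 2 ∧
      (((M + 1) * (r * s ^ m + 1)) ^ k * (2 * t) ^ k : ℕ) * Real.exp (ε / 2) / δ
        ≤ β / 2 * Real.exp (ε / 2) ^ T ∧
      ((T * (r * s + s') : ℕ) : ℝ) ≤ soft 2251560 2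
        (((Real.log (1 / δ) + k * Real.log t) / ε
            + (m * k + k * Real.log (1 / β)) / (α * ε))
          * ((m * k + k * Real.log (1 / β)) / α ^ 3)) := by
  have hk' : (1 : ℝ) ≤ k := by exact_mod_cast hk
  have hm' : (1 : ℝ) ≤ m := by exact_mod_cast hm
  have ht' : (1 : ℝ) ≤ t := by exact_mod_cast ht
  set l := Real.log (1 / β) with hl
  have hl0 : 0 ≤ l := Real.log_nonneg (by rw [le_div_iff₀ hβ]; linarith)
  have hlexp : Real.exp (-l) = β := by
    rw [hl, one_div, Real.log_inv, neg_neg, Real.exp_log hβ]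
  have hd0 : 0 ≤ Real.log (1 / δ) := Real.log_nonneg (by rw [le_div_iff₀ hδ]; linarith)
  have hlt0 : 0 ≤ Real.log t := Real.log_nonneg ht'
  set B := m * k + k * l with hB
  have hmk : (m : ℝ) * k ≤ B := le_add_of_nonneg_right (by positivity)
  have hkl : k * l ≤ B := le_add_of_nonneg_left (by positivity)
  have hkB : (k : ℝ) ≤ B := (le_mul_of_one_le_left (by positivity) hm').trans hmk
  have hlB : l ≤ B := (le_mul_of_one_le_left hl0 hk').trans hkl
  have hB1 : 1 ≤ B := by linarith
  set P := (Real.log (1 / δ) + k * Real.log t) / ε + B / (α * ε) with hP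
  set Q := B / α ^ 3 with hQ
  set x := P * Q with hx
  clear_value l B P Q x
  have hα2 : α ^ 2 ≤ 1 := pow_le_one₀ hα.le hα1.le
  have hα3 : α ^ 3 ≤ 1 := pow_le_one₀ hα.le hα1.le
  have hBQ : B ≤ Q := by
    rw [hQ, le_div_iff₀ (by positivity)]
    exact mul_le_of_le_one_right (by linarith) hα3
  have hBQ1 : B / α ≤ Q := by
    rw [hQ]
    gcongr
    exact pow_le_of_le_one hα.le hα1.le (by norm_num)
  have hBQ2 : B / α ^ 2 ≤ Q := by
    rw [hQ]
    exact div_le_div_of_nonneg_left (by linarith) (by positivity)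
      (pow_le_pow_of_le_one hα.le hα1.le (by norm_num))
  have hA0 : 0 ≤ (Real.log (1 / δ) + k * Real.log t) / ε := by positivity
  -- The number of batches only needs `B / ε`; with `ε ≤ 6 * k` this also keeps `P` away from zero,
  -- so that `P` and `Q` are `O(x)` and logarithms of all sizes are `O(1 + L)`.
  have hPε : (Real.log (1 / δ) + k * Real.log t) / ε + B / ε ≤ P := by
    rw [hP]
    gcongr
    exact mul_le_of_le_one_left hε.le hα1.le
  have hεB : 1 ≤ 6 * (B / ε) := by
    rw [← mul_div_assoc, le_div_iff₀ hε]
    linarith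
  have hP0 : 1 / 6 ≤ P := by linarith
  have hQ1 : 1 ≤ Q := hB1.trans hBQ
  have hQx : Q ≤ 6 * x := by
    have := mul_le_mul_of_nonneg_right hP0 (zero_le_one.trans hQ1)
    linarith
  have hPx : P ≤ x := by
    rw [hx]
    exact le_mul_of_one_le_right ((by norm_num : (0 : ℝ) ≤ 1 / 6).trans hP0) hQ1
  have hx0 : 0 ≤ x := by linarith
  set L := Real.log (1 + x) with hL
  have hL0 : 0 ≤ L := Real.log_nonneg (by linarith)
  have hexpL : Real.exp L = 1 + x := Real.exp_log (by linarith)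
  have hLx : 1 + L ≤ 1 + x := by
    rw [← hexpL]
    linarith [Real.add_one_le_exp L]
  have hkα : k / α ≤ Q := le_trans (by gcongr) hBQ1
  obtain ⟨M, hM1, hM2⟩ := exists_nat_between (y := 50 * k / α) (by positivity)
  have hkα1 : (k : ℝ) ≤ k / α := by
    rw [le_div_iff₀ hα]
    exact mul_le_of_le_one_right (by linarith) hα1.le
  have hM2' : (M : ℝ) ≤ 51 * (k / α) := by
    rw [mul_div_assoc] at hM2
    linarith
  have hkM : (k : ℝ) ≤ M := by
    rw [mul_div_assoc] at hM1
    linarith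
  have hM0 : (0 : ℝ) < M := by linarith
  -- Chosen so that `2 ^ m * exp (-s / (2 * M)) ≤ exp (-3) * β`.
  obtain ⟨s, hs1, hs2⟩ := exists_nat_between (y := 2 * M * (m + l + 3)) (by positivity)
  have hs0 : (1 : ℝ) ≤ s :=
    (one_le_mul_of_one_le_of_one_le (by linarith : (1 : ℝ) ≤ 2 * M)
      (by linarith : (1 : ℝ) ≤ m + l + 3)).trans hs1
  have hs2' : (s : ℝ) ≤ 409 * (B / α) := by
    have h1 : 2 * M * (m + l + 3) ≤ 2 * (51 * (k / α)) * (m + l + 3) := by gcongr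
    have h2 : 2 * (51 * (k / α)) * (m + l + 3) = 102 * ((B + 3 * k) / α) := by
      rw [hB]; ring
    have h3 : (B + 3 * k) / α ≤ 4 * (B / α) := by
      rw [← mul_div_assoc]
      gcongr
      linarith
    have h4 : 1 ≤ B / α := by
      rw [le_div_iff₀ hα]
      linarith
    linarith
  -- The blocks must satisfy `4 * k * T ≤ 2 ^ r`, although `T` is chosen later and depends on `r`.
  -- It does so only through a logarithm, so `k * T` is polynomial in `1 + x` and `r` of order `1 +
  -- L` is enough.
  obtain ⟨r, hr1, hr2⟩ := exists_nat_between (y := 40 * (1 + L)) (by positivity)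
  have hr0 : (1 : ℝ) ≤ r := by linarith
  have hr2' : (r : ℝ) ≤ 41 * (1 + L) := by linarith
  have hrn : 1 ≤ r := by exact_mod_cast hr0
  have hsn : 1 ≤ s := by exact_mod_cast hs0
  clear_value L
  set lam := Real.log ((M + 1) * (2 * r * s)) with hlam
  have hlam0 : 0 ≤ lam := by
    refine Real.log_nonneg ?_
    have : (1 : ℝ) ≤ r * s := one_le_mul_of_one_le_of_one_le hr0 hs0
    exact one_le_mul_of_one_le_of_one_le (by linarith) (by linarith)
  have hlam1 : lam ≤ 20 * (1 + L) := by
    have h1 : ((M : ℝ) + 1) * (2 * r * s) ≤ Real.exp (20 * (1 + L)) := by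
      calc ((M : ℝ) + 1) * (2 * r * s)
          ≤ (312 * (1 + x)) * (2 * (41 * (1 + x)) * (2454 * (1 + x))) := by
            gcongr
            · linarith
            · linarith
            · linarith
        _ = 62783136 * (1 + x) ^ 3 := by ring
        _ ≤ Real.exp (20 : ℕ) * Real.exp L ^ 3 := by
            rw [hexpL]
            gcongr
            exact le_exp_of_le_pow 20 (by norm_num)
        _ = Real.exp (20 + 3 * L) := by
            rw [← Real.exp_nat_mul, ← Real.exp_add]
            norm_num
        _ ≤ _ := Real.exp_le_exp.2 (by linarith)
    rw [hlam, Real.log_le_iff_le_exp (by positivity)]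
    exact h1
  set Ξ : ℝ := (((M : ℝ) + 1) * (r * s ^ m + 1)) ^ k with hΞ
  have hΞ1 : 1 ≤ Ξ := one_le_pow₀ <| one_le_mul_of_one_le_of_one_le
    (le_add_of_nonneg_left hM0.le) (le_add_of_nonneg_left (by positivity))
  have hΞ0 : 0 < Ξ := by positivity
  have hlogΞ : Real.log Ξ ≤ B * lam := by
    rw [hΞ, Real.log_pow]
    calc k * Real.log (((M : ℝ) + 1) * (r * s ^ m + 1)) ≤ k * (m * lam) := by
          gcongr
          exact log_mixIndex_le hrn hsn hm
      _ = m * k * lam := by ring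
      _ ≤ B * lam := by gcongr
  clear_value lam Ξ
  set N : ℝ := Ξ * (2 * t) ^ k with hN
  have hN0 : 0 < N := by positivity
  have hlogN : Real.log N ≤ B * lam + B + k * Real.log t := by
    have h1 : Real.log ((2 * t) ^ k) = k * Real.log 2 + k * Real.log t := by
      rw [Real.log_pow, Real.log_mul two_ne_zero (by positivity), mul_add]
    have h2 : k * Real.log 2 ≤ k * 1 := by
      gcongr
      linarith [Real.log_two_lt_d9]
    rw [hN, Real.log_mul hΞ0.ne' (by positivity), h1]
    linarith
  have hlog2 : Real.log 2 ≤ 1 := by linarith [Real.log_two_lt_d9]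
  have hlogN0 : 0 ≤ Real.log N := by
    refine Real.log_nonneg ?_
    exact one_le_mul_of_one_le_of_one_le hΞ1 (one_le_pow₀ (by linarith))
  clear_value N
  -- `exp y = 2 * N * exp (ε / 2) / (β * δ)`, so `T ≥ 2 * y / ε` is exactly the condition of the
  -- selection.
  set y := Real.log 2 + l + Real.log N + ε / 2 + Real.log (1 / δ) with hy
  have hy0 : 0 ≤ y := by
    have := Real.log_pos one_lt_two
    positivity
  obtain ⟨T, hT1, hT2⟩ := exists_nat_between (y := 2 / ε * y) (by positivity)
  have hT0 : 0 < T := by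
    have h1 : (0 : ℝ) < 2 / ε * y := by
      have := Real.log_pos one_lt_two
      positivity
    exact_mod_cast h1.trans_le hT1
  have hT0' : (1 : ℝ) ≤ T := by exact_mod_cast hT0
  have hT2' : (T : ℝ) ≤ 58 * (1 + L) * P := by
    have h1 : 2 / ε * y ≤ 2 / ε * (Real.log (1 / δ) + k * Real.log t + B * (20 * (1 + L)) + 3 * B
        + ε / 2) := by
      gcongr
      have : B * lam ≤ B * (20 * (1 + L)) := by gcongr
      rw [hy]
      linarith
    have h2 : 2 / ε * (Real.log (1 / δ) + k * Real.log t + B * (20 * (1 + L)) + 3 * B + ε / 2)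
        = 2 * ((Real.log (1 / δ) + k * Real.log t) / ε) + (40 * (1 + L) + 6) * (B / ε) + 1 := by
      field_simp
      ring
    have hBε : 0 ≤ B / ε := by positivity
    calc (T : ℝ) ≤ 2 * ((Real.log (1 / δ) + k * Real.log t) / ε)
          + (40 * (1 + L) + 6) * (B / ε) + 2 := by linarith
      _ ≤ 58 * (1 + L) * ((Real.log (1 / δ) + k * Real.log t) / ε + B / ε) := by
          linarith [mul_nonneg hL0 hA0, mul_nonneg hL0 hBε]
      _ ≤ _ := by gcongr
  have hTx : (T : ℝ) ≤ 58 * (1 + x) ^ 2 := by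
    calc (T : ℝ) ≤ 58 * (1 + L) * P := hT2'
      _ ≤ 58 * (1 + x) * (1 + x) := by
          gcongr
          linarith
      _ = _ := by ring
  have hlogT : Real.log T ≤ 5 + 2 * L := by
    rw [Real.log_le_iff_le_exp (by positivity)]
    calc (T : ℝ) ≤ 58 * (1 + x) ^ 2 := hTx
      _ ≤ Real.exp (5 : ℕ) * Real.exp L ^ 2 := by
          rw [hexpL]
          gcongr
          exact le_exp_of_le_pow 5 (by norm_num)
      _ = Real.exp (5 + 2 * L) := by
          rw [← Real.exp_nat_mul, ← Real.exp_add]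
          norm_num
  have hkT : 4 * k * T ≤ (2 : ℝ) ^ r := by
    calc 4 * k * T ≤ 4 * (6 * (1 + x)) * (58 * (1 + x) ^ 2) := by
          gcongr
          linarith
      _ = 1392 * (1 + x) ^ 3 := by ring
      _ ≤ Real.exp (8 : ℕ) * Real.exp L ^ 3 := by
          rw [hexpL]
          gcongr
          exact le_exp_of_le_pow 8 (by norm_num)
      _ = Real.exp (8 + 3 * L) := by
          rw [← Real.exp_nat_mul, ← Real.exp_add]
          norm_num
      _ ≤ Real.exp (r * Real.log 2) := by
          refine Real.exp_le_exp.2 ?_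
          have h1 : 40 * (1 + L) * (1 / 2) ≤ r * Real.log 2 := by
            gcongr
            linarith [Real.log_two_gt_d9]
          linarith
      _ = 2 ^ r := by rw [Real.exp_nat_mul, Real.exp_log two_pos]
  clear_value y
  set v := Real.log (8 * T * Ξ ^ 2 / β) with hv
  have hv0 : 0 < v := by
    refine Real.log_pos ?_
    rw [lt_div_iff₀ hβ]
    linarith [one_le_mul_of_one_le_of_one_le hT0' (one_le_pow₀ hΞ1 (n := 2))]
  have hv1 : v ≤ 49 * B * (1 + L) := by
    have h8 : Real.log 8 ≤ 3 := by
      rw [Real.log_le_iff_le_exp (by norm_num)]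
      simpa using le_exp_of_le_pow (y := 8) 3 (by norm_num)
    have h1 : v = Real.log 8 + Real.log T + 2 * Real.log Ξ + l := by
      rw [hv, div_eq_mul_one_div, Real.log_mul (by positivity) (by positivity),
        Real.log_mul (by positivity) (by positivity), Real.log_mul (by norm_num) (by positivity),
        Real.log_pow, ← hl]
      norm_num
    have h2 : B * lam ≤ B * (20 * (1 + L)) := by gcongr
    rw [h1]
    linarith [le_mul_of_one_le_left hL0 hB1]
  -- `450 = 30 ^ 2 / 2` makes the Hoeffding exponent `2 * s' * (α / 30) ^ 2` at least `v`, where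
  -- `exp (-v)` pays for a union over all batches and all pairs of names.
  obtain ⟨s', hs'1, hs'2⟩ := exists_nat_between (y := 450 / α ^ 2 * v) (by positivity)
  have hs'0 : 0 < s' := by
    have : (0 : ℝ) < 450 / α ^ 2 * v := by positivity
    exact_mod_cast this.trans_le hs'1
  have hs'2' : (s' : ℝ) ≤ 22051 * (1 + L) * Q := by
    have h1 : 450 / α ^ 2 * v ≤ 450 / α ^ 2 * (49 * B * (1 + L)) := by gcongr
    have h2 : 450 / α ^ 2 * (49 * B * (1 + L)) = 22050 * (1 + L) * (B / α ^ 2) := by ring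
    have h3 : 22050 * (1 + L) * (B / α ^ 2) ≤ 22050 * (1 + L) * Q := by gcongr
    linarith [one_le_mul_of_one_le_of_one_le (by linarith : 1 ≤ 1 + L) hQ1]
  refine ⟨M, r, s, s', T, by exact_mod_cast hkM, hs'0, ?_, ?_, ?_, ?_⟩
  · rw [div_le_div_iff₀ hM0 (by norm_num)]
    rw [div_le_iff₀ hα] at hM1
    linarith
  · have hblock : 2 ^ m * (1 - 1 / (2 * (M : ℝ))) ^ s ≤ β / 4 := by
      have hM1' : (1 : ℝ) ≤ M := hk'.trans hkM
      have h0 : 0 ≤ 1 - 1 / (2 * (M : ℝ)) := by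
        rw [sub_nonneg, div_le_one (by positivity)]
        linarith
      calc 2 ^ m * (1 - 1 / (2 * (M : ℝ))) ^ s
          ≤ Real.exp 1 ^ m * Real.exp (-(1 / (2 * (M : ℝ)))) ^ s := by
            gcongr
            · linarith [Real.exp_one_gt_d9]
            · linarith [Real.add_one_le_exp (-(1 / (2 * (M : ℝ))))]
        _ = Real.exp (m - s / (2 * M)) := by
            rw [← Real.exp_nat_mul, ← Real.exp_nat_mul, ← Real.exp_add]
            congr 1
            ring
        _ ≤ Real.exp (-3 + -l) := by
            refine Real.exp_le_exp.2 ?_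
            have : m + l + 3 ≤ s / (2 * M) := by
              rw [le_div_iff₀ (by positivity)]
              linarith
            linarith
        _ = Real.exp (-3) * β := by rw [Real.exp_add, hlexp]
        _ ≤ 1 / 4 * β := by
            gcongr
            rw [Real.exp_neg, one_div]
            have h8 : (4 : ℝ) ≤ Real.exp 3 := by
              simpa using le_exp_of_le_pow (y := 4) 3 (by norm_num)
            gcongr
        _ = β / 4 := by ring
    have hpow : (2 * β' + 2 ^ m * (1 - 1 / (2 * (M : ℝ))) ^ s) ^ r ≤ β * (1 / 2 ^ r) := by
      have hM1' : (1 : ℝ) ≤ M := hk'.trans hkM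
      have h0 : 0 ≤ 1 - 1 / (2 * (M : ℝ)) := by
        rw [sub_nonneg, div_le_one (by positivity)]
        linarith
      calc (2 * β' + 2 ^ m * (1 - 1 / (2 * (M : ℝ))) ^ s) ^ r ≤ (β / 2) ^ r := by
            gcongr
            linarith
        _ = β ^ r * (1 / 2 ^ r) := by rw [div_pow, div_eq_mul_one_div]
        _ ≤ β * (1 / 2 ^ r) := by
            gcongr
            exact pow_le_of_le_one hβ.le hβ1.le (by lia)
    have h1 : T * (k * (2 * β' + 2 ^ m * (1 - 1 / (2 * (M : ℝ))) ^ s) ^ r) ≤ β / 4 := by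
      calc T * (k * (2 * β' + 2 ^ m * (1 - 1 / (2 * (M : ℝ))) ^ s) ^ r)
          ≤ T * (k * (β * (1 / 2 ^ r))) := by gcongr
        _ = β / 4 * (4 * k * T / 2 ^ r) := by ring
        _ ≤ β / 4 * 1 := by
            gcongr
            exact (div_le_one (by positivity)).2 hkT
        _ = β / 4 := mul_one _
    have h2 : Real.exp (-(2 * s' * (α / 30) ^ 2)) ≤ β / (8 * T * Ξ ^ 2) := by
      calc Real.exp (-(2 * s' * (α / 30) ^ 2)) ≤ Real.exp (-v) := by
            refine Real.exp_le_exp.2 (neg_le_neg ?_)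
            rw [div_mul_eq_mul_div, div_le_iff₀ (by positivity)] at hs'1
            linarith
        _ = _ := by rw [Real.exp_neg, hv, Real.exp_log (by positivity), inv_div]
    have h3 : T * (2 * Ξ ^ 2 * Real.exp (-(2 * s' * (α / 30) ^ 2))) ≤ β / 4 := by
      calc T * (2 * Ξ ^ 2 * Real.exp (-(2 * s' * (α / 30) ^ 2)))
          ≤ T * (2 * Ξ ^ 2 * (β / (8 * T * Ξ ^ 2))) := by gcongr
        _ = β / 4 := by
            field_simp
            norm_num
    push_cast
    rw [mul_add, ← hΞ]
    linarith
  · have h1 : y ≤ ε / 2 * T := by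
      rw [div_mul_eq_mul_div, div_le_iff₀ hε] at hT1
      linarith
    have h2 : Real.exp y = 2 * (1 / β) * N * Real.exp (ε / 2) * (1 / δ) := by
      rw [hy, Real.exp_add, Real.exp_add, Real.exp_add, Real.exp_add, Real.exp_log two_pos, hl,
        Real.exp_log (by positivity), Real.exp_log hN0, Real.exp_log (by positivity)]
    rw [← Real.exp_nat_mul]
    calc ((((M + 1) * (r * s ^ m + 1)) ^ k * (2 * t) ^ k : ℕ) : ℝ) * Real.exp (ε / 2) / δ
        = β / 2 * Real.exp y := by
          rw [h2, hN, hΞ]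
          push_cast
          field_simp
      _ ≤ _ := by
          gcongr
          linarith
  · push_cast
    have h1 : (r : ℝ) * s ≤ 16769 * (1 + L) * Q := by
      calc (r : ℝ) * s ≤ (41 * (1 + L)) * (409 * Q) := by
            gcongr
            linarith
        _ = _ := by ring
    -- `38820 = 16769 + 22051`. One factor `1 + L` comes from the number of batches and one from
    -- their size, so the logarithm has exponent 2.
    calc (T : ℝ) * (r * s + s') ≤ (58 * (1 + L) * P) * (38820 * (1 + L) * Q) := by
          gcongr
          linarith
      _ = soft 2251560 2 x := by
          rw [soft, ← hL, hx]
          ring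

end Parameters

end PrivateMixtures

theorem corollary3p1 :
    ∃ (C₀ C : ℝ) (c₀ c : ℕ), 0 < C₀ ∧ 0 < C ∧
      ∀ (X : Type*) [MeasurableSpace X] [MeasurableSpace.CountablyGenerated X]
        (μ : Measure X) [SigmaFinite μ]
        (F : Set (Measure X)) (_hF : IsDistributionClass μ F) (_hne : F.Nonempty)
        (α β β' ε δ : ℝ) (k m t : ℕ)
        (_hα : 0 < α ∧ α < 1) (_hβ : 0 < β ∧ β < 1) (_hβ' : 0 < β' ∧ β' < 1)
        (_hε : 0 < ε ∧ ε ≤ 6 * k) (_hδ : 0 < δ ∧ δ ≤ 1) (_hk : 1 ≤ k) (_hm : 1 ≤ m)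
        (_hcover : AdmitsLocallySmallCover μ F t (2 * α / 15) (α / 15))
        (_hlearn : PACLearnable μ (fun P : F => (P : Measure X)) (α / 15) β' m)
        (_hconf : soft C₀ c₀
            (Real.log (1 + m * k * Real.log (1 + t / (α * δ)) / (ε * β))) ≤ Real.log (1 / β')),
        ∃ n : ℕ,
          (n : ℝ) ≤ soft C c
            (((Real.log (1 / δ) + k * Real.log t) / ε
                + (m * k + k * Real.log (1 / β)) / (α * ε))
              * ((m * k + k * Real.log (1 / β)) / α ^ 3)) ∧
          DPPACLearnable μ (KMix.toMeasure : KMix k F → Measure X) ε δ α β n := by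
  refine ⟨100, 2251560, 0, 2, by norm_num, by norm_num, ?_⟩
  rintro X _ _ μ _ F hF hne α β β' ε δ k m t ⟨hα, hα1⟩ ⟨hβ, hβ1⟩ ⟨hβ', -⟩ ⟨hε, hεk⟩ ⟨hδ, hδ1⟩ hk hm
    hcover hlearn hconf
  have ht : 1 ≤ t := hcover.one_le hne
  have hββ := two_mul_le_of_soft_le hα hα1 hβ hβ' hε hεk hδ hδ1 hm ht hconf
  obtain ⟨M, r, s, s', T, hkM, hs', hMα, hfail, hT, hn⟩ :=
    exists_parameters hα hα1 hβ hβ1 hβ' hε hεk hδ hδ1 hk hm ht hββ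
  exact ⟨_, hn, dpPACLearnable_kMix hF hne hα hβ hβ' hε hδ hδ1 hk hkM hs' ht hcover hlearn hMα
    hfail hT⟩
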